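/- **Definitions.** A Dyck path of size $n$ is a word with $n$ letters $u$ and $n$ letters $d$ every prefix of which has at least as many $u$'s as $d$'s; $\bullet$ is the empty one. $\mathrm{Val}(P)$ and $\mathrm{DR}(P)$ are the numbers of factors $du$ and $uu$ of $P$, and $c_0(P)$ is the number of non-empty prefixes of $P$ that are Dyck paths. The Tamari order $\preceq$ is the reflexive transitive closure of the right rotations $X\,d\,P_1\,Y \to X\,P_1\,d\,Y$, where $P_1$ is a non-empty Dyck path returning to the axis only at its end. A Tamari interval is a pair $[P,Q]$ with $P\preceq Q$. Conjugation of Dyck paths is defined by $\mathrm{Conj}(\bullet)=\bullet$ and $\mathrm{Conj}(P_1uP_2d)=\mathrm{Conj}(P_2)\,u\,\mathrm{Conj}(P_1)\,d$ for Dyck paths $P_1,P_2$, and $\mathrm{Conj}_{\mathcal I}([P,Q])=[\mathrm{Conj}(Q),\mathrm{Conj}(P)]$, which is again a Tamari interval. A non-empty fighting fish is a word obtained from $ENWS$ by finitely many replacements of a factor $W$ by $NWS$, of a factor $N$ by $ENW$, or of a factor $WN$ by $NW$. An extended fighting fish is a word obtained from such a word by replacing some (possibly none) of its factors $WN$ by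 the letter $V$, or the empty fish $\varepsilon=EVS$. Its conjugate $\mathrm{Conj}_{\mathcal F}(F)$ is obtained by reversing the word and exchanging $E\leftrightarrow S$ and $N\leftrightarrow W$; $|F|_x$ is the number of letters $x$ in $F$. Put $\mathrm{jaw}(\varepsilon)=0$; every extended fighting fish $F\neq\varepsilon$ can be written $F=E^jNG$, and $\mathrm{jaw}(F)=j$. For $F_1=G_1S$ and $F_2=E^{j}NG_2$, both different from $\varepsilon$, with $j=\mathrm{jaw}(F_2)$, put $F_1\odot F_2=E^{j}G_1G_2$; and $\varepsilon\odot F=F\odot\varepsilon=F$. For $F=E^jNG\ne\varepsilon$ with $j=\mathrm{jaw}(F)$ and $1\le i\le j+1$, the $i$-augmentation $A_i(F)$ is $E^iNE^{j-i}NGS$ if $i\le j$, and $E^{j+1}NVGS$ if $i=j+1$; moreover $A_1(\varepsilon)=ENWS$. These are again extended fighting fish. Let $\Phi$ be the map from Tamari intervals to extended fighting fish defined recursively by $\Phi([\bullet,\bullet])=\varepsilon$ and $$\Phi\big([\,uLdR\,P_2,\;uQ_1d\,Q_2\,]\big)=A_{c_0(R)+1}\big(\Phi([LR,Q_1])\big)\odot\Phi([P_2,Q_2])$$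 for all Dyck paths $L,R$ and all Tamari intervals $[LR,Q_1]$ and $[P_2,Q_2]$. (Every Tamari interval other than $[\bullet,\bullet]$ is of the form on the left in exactly one way, and $\mathrm{jaw}(\Phi([P,Q]))=c_0(P)$, so $\Phi$ is well defined.) **Proposition.** For every Tamari interval $I=[P,Q]$, $$\mathrm{Conj}_{\mathcal F}(\Phi(I))=\Phi(\mathrm{Conj}_{\mathcal I}(I)),\qquad |\Phi(I)|_E=\mathrm{Val}(P)+1,\qquad |\Phi(I)|_S=\mathrm{DR}(Q)+1,$$ and, if $I\neq[\bullet,\bullet]$, also $$|\Phi(I)|_N=\mathrm{DR}(P)+1,\qquad |\Phi(I)|_W=\mathrm{Val}(Q)+1 .$$ -/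

import Mathlib

open DyckStep

namespace DyckWord

/-- The number of valleys of `P`: occurrences of the factor `du`. -/
def val (P : DyckWord) : ℕ := (P.toList.zip P.toList.tail).count (D, U)

/-- The number of double rises of `P`: occurrences of the factor `uu`. -/
def doubleRises (P : DyckWord) : ℕ := (P.toList.zip P.toList.tail).count (U, U)

/-- The number of non-initial contacts of `P`, i.e. of non-empty prefixes of `P` that end on the
`x`-axis. -/
def contacts (P : DyckWord) : ℕ :=
  (List.range P.toList.length).countP fun k =>
    (P.toList.take (k + 1)).count U = (P.toList.take (k + 1)).count D

/-- `P'` is obtained from `P` by a right rotation: `P = X d P₁ Y` and `P' = X P₁ d Y`, where `P₁`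
is a non-empty Dyck path that returns to the `x`-axis only at its end. -/
def RightRotation (P P' : DyckWord) : Prop :=
  ∃ (X Y : List DyckStep) (P₁ : DyckWord), P₁.IsNested ∧
    P.toList = X ++ [D] ++ P₁.toList ++ Y ∧ P'.toList = X ++ P₁.toList ++ [D] ++ Y

/-- The Tamari order: `P'` is obtained from `P` by a possibly empty series of right rotations.
(This is not Mathlib's order `≤` on `DyckWord`.) -/
def TamariLE : DyckWord → DyckWord → Prop := Relation.ReflTransGen RightRotation

/-- Auxiliary function for the conjugation: if `s` is the conjugate of `X`, then `conjAux s P` is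
the conjugate of the concatenation `X P`. -/
def conjAux (s P : DyckWord) : DyckWord :=
  if _h : P = 0 then s else conjAux (conjAux 0 P.insidePart + s.nest) P.outsidePart
termination_by P.semilength
decreasing_by exacts [semilength_insidePart_lt _h, semilength_outsidePart_lt _h]

/-- The conjugation of Dyck paths. It is characterized by `conj_zero` and `conj_add_nest` below:
the conjugate of the empty path is empty, and the conjugate of `P₁ u P₂ d` is
`conj P₂ u (conj P₁) d`. -/
def conj (P : DyckWord) : DyckWord := conjAux 0 P

theorem first_induction {p : DyckWord → Prop} (h0 : p 0)
    (h1 : ∀ A C, p A → p C → p (A.nest + C)) (P : DyckWord) : p P := by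
  by_cases h : P = 0
  · exact h ▸ h0
  · rw [← nest_insidePart_add_outsidePart h]
    exact h1 _ _ (first_induction h0 h1 _) (first_induction h0 h1 _)
termination_by P.semilength
decreasing_by exacts [semilength_insidePart_lt h, semilength_outsidePart_lt h]

theorem nest_add_inj {A B C E : DyckWord} (h : A.nest + B = C.nest + E) : A = C ∧ B = E := by
  have h1 := congrArg insidePart h
  have h2 := congrArg outsidePart h
  simpa using And.intro h1 h2

theorem nest_add_ne_zero (A C : DyckWord) : A.nest + C ≠ 0 := by
  intro h
  have := congrArg semilength h
  simp at this

theorem conjAux_zero (s : DyckWord) : conjAux s 0 = s := by rw [conjAux]; simp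

theorem conjAux_nest_add (s A C : DyckWord) :
    conjAux s (A.nest + C) = conjAux (conj A + s.nest) C := by
  rw [conjAux, dif_neg (nest_add_ne_zero A C)]
  simp [conj]

theorem conjAux_add (P X : DyckWord) : ∀ s, conjAux s (P + X) = conjAux (conjAux s P) X := by
  induction P using first_induction with
  | h0 => intro s; simp [conjAux_zero]
  | h1 A C _ ih => intro s; rw [add_assoc, conjAux_nest_add, conjAux_nest_add, ih]

theorem conj_zero : conj 0 = 0 := conjAux_zero 0

theorem conj_add_nest (P₁ P₂ : DyckWord) : conj (P₁ + P₂.nest) = conj P₂ + (conj P₁).nest := by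
  rw [conj, conjAux_add, ← add_zero P₂.nest, conjAux_nest_add, conjAux_zero]
  rfl

theorem contacts_zero : contacts 0 = 0 := rfl

theorem contacts_add (P Q : DyckWord) : contacts (P + Q) = contacts P + contacts Q := by
  have e : (P + Q).toList = P.toList ++ Q.toList := rfl
  unfold contacts
  rw [e, List.length_append, List.range_add, List.countP_append, List.countP_map]
  congr 1
  · apply List.countP_congr
    intro k hk
    rw [List.mem_range] at hk
    rw [List.take_append_of_le_length (by omega)]
  · apply List.countP_congr
    intro k hk
    have := P.count_U_eq_count_D
    simp only [Function.comp, decide_eq_true_eq]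
    rw [add_assoc, List.take_length_add_append, List.count_append, List.count_append]
    omega

theorem contacts_nest (P : DyckWord) : contacts P.nest = 1 := by
  have e : P.nest.toList.length = (P.toList.length + 1) + 1 := by simp [nest]
  unfold contacts
  rw [e, List.range_succ, List.countP_append]
  have h1 : List.countP (fun k => decide ((P.nest.toList.take (k + 1)).count U =
      (P.nest.toList.take (k + 1)).count D)) (List.range (P.toList.length + 1)) = 0 := by
    rw [List.countP_eq_zero]
    intro k hk
    rw [List.mem_range] at hk
    have := (IsNested.nest (p := P)).2 (i := k + 1) (by omega) (by omega)
    simp only [decide_eq_true_eq]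
    omega
  rw [h1, List.countP_singleton, ← e, List.take_length]
  simp [P.nest.count_U_eq_count_D]

theorem add_toList (P Q : DyckWord) : (P + Q).toList = P.toList ++ Q.toList := rfl

theorem nest_toList (P : DyckWord) : P.nest.toList = U :: P.toList ++ [D] := rfl

theorem TamariLE.refl (P : DyckWord) : TamariLE P P := Relation.ReflTransGen.refl

theorem TamariLE.trans {P Q R : DyckWord} (h : TamariLE P Q) (h' : TamariLE Q R) :
    TamariLE P R := Relation.ReflTransGen.trans h h'

theorem TamariLE.semilength_eq {P Q : DyckWord} (h : TamariLE P Q) :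
    P.semilength = Q.semilength := by
  induction h with
  | refl => rfl
  | tail _ h ih =>
    obtain ⟨X, Y, P₁, -, h1, h2⟩ := h
    rw [ih, semilength, semilength, h1, h2]
    simp only [List.count_append]
    omega

theorem TamariLE.add {P P' Q Q' : DyckWord} (h : TamariLE P P') (h' : TamariLE Q Q') :
    TamariLE (P + Q) (P' + Q') := by
  refine TamariLE.trans (Q := P' + Q) ?_ ?_
  · refine Relation.ReflTransGen.lift (p := RightRotation) (fun R => R + Q) ?_ _ _ h
    rintro a b ⟨X, Y, P₁, h1, h2, h3⟩
    exact ⟨X, Y ++ Q.toList, P₁, h1, by simp [add_toList, h2], by simp [add_toList, h3]⟩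
  · refine Relation.ReflTransGen.lift (p := RightRotation) (fun R => P' + R) ?_ _ _ h'
    rintro a b ⟨X, Y, P₁, h1, h2, h3⟩
    exact ⟨P'.toList ++ X, Y, P₁, h1, by simp [add_toList, h2], by simp [add_toList, h3]⟩

theorem TamariLE.nest {P P' : DyckWord} (h : TamariLE P P') : TamariLE P.nest P'.nest := by
  refine Relation.ReflTransGen.lift (p := RightRotation) DyckWord.nest ?_ _ _ h
  rintro a b ⟨X, Y, P₁, h1, h2, h3⟩
  exact ⟨U :: X, Y ++ [D], P₁, h1, by simp [nest_toList, h2], by simp [nest_toList, h3]⟩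

theorem TamariLE.rotate (A B : DyckWord) : TamariLE (A.nest + B.nest) (A + B.nest).nest :=
  Relation.ReflTransGen.single ⟨U :: A.toList, [], B.nest, IsNested.nest,
    by simp [nest_toList, add_toList], by simp [nest_toList, add_toList]⟩

theorem TamariLE.nest_add (A B : DyckWord) : TamariLE (A.nest + B) (A + B).nest := by
  induction B using first_induction generalizing A with
  | h0 => simpa using TamariLE.refl A.nest
  | h1 B C _ ih =>
    rw [← add_assoc, ← add_assoc]
    exact ((TamariLE.rotate A B).add (TamariLE.refl C)).trans (ih _)

/-- The right rotations, organized along the decomposition `u A d C`. -/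
inductive Rot : DyckWord → DyckWord → Prop
  | rot (A B C : DyckWord) : Rot (A.nest + (B.nest + C)) ((A + B.nest).nest + C)
  | inside (A A' C : DyckWord) : Rot A A' → Rot (A.nest + C) (A'.nest + C)
  | right (A C C' : DyckWord) : Rot C C' → Rot (A.nest + C) (A.nest + C')

theorem suffix_count (P : DyckWord) {X Y : List DyckStep} (h : P.toList = X ++ Y) :
    Y.count U ≤ Y.count D := by
  have h1 := P.count_U_eq_count_D
  have h2 := P.count_D_le_count_U X.length
  rw [h] at h1 h2
  rw [List.take_left' rfl] at h2
  simp only [List.count_append] at h1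
  omega

theorem exists_of_append (P : DyckWord) {X Y : List DyckStep} (h : P.toList = X ++ Y)
    (hX : X.count U = X.count D) : ∃ A B : DyckWord, A.toList = X ∧ B.toList = Y := by
  have hX' : (P.toList.take X.length).count U = (P.toList.take X.length).count D := by
    rw [h, List.take_left' rfl, hX]
  refine ⟨P.take X.length hX', P.drop X.length hX', ?_, ?_⟩
  · simp [take, h]
  · simp [drop, h]

theorem IsNested.eq_nest {P : DyckWord} (h : P.IsNested) : ∃ B : DyckWord, P = B.nest :=
  ⟨_, (P.nest_denest h).symm⟩

theorem rot_of_rightRotation (P : DyckWord) :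
    ∀ P' : DyckWord, RightRotation P P' → Rot P P' := by
  induction P using first_induction with
  | h0 =>
    rintro P' ⟨X, Y, P₁, -, h, -⟩
    have := congrArg List.length h
    simp [show (0 : DyckWord).toList = [] from rfl] at this
  | h1 A C ihA ihC =>
    rintro P' ⟨X, Y, P₁, hn, h, h'⟩
    obtain ⟨B, rfl⟩ := hn.eq_nest
    rcases X with _ | ⟨x, X⟩
    · simp [add_toList, nest_toList] at h
    have h0 : U = x ∧ A.toList ++ (D :: C.toList) = X ++ (D :: (B.nest.toList ++ Y)) := by
      simpa [add_toList, nest_toList] using h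
    obtain ⟨rfl, h0⟩ := h0
    rw [List.append_eq_append_iff] at h0
    rcases h0 with ⟨Z, rfl, h2⟩ | ⟨Z, h1, h2⟩
    · rcases Z with _ | ⟨z, Z⟩
      · have h2 : C.toList = B.nest.toList ++ Y := by simpa using h2
        obtain ⟨B', Y', hB, rfl⟩ := C.exists_of_append h2 B.nest.count_U_eq_count_D
        have hC : C = B.nest + Y' := by ext1; exact h2
        have hP : P' = (A + B.nest).nest + Y' := by
          ext1; rw [h']; simp [add_toList, nest_toList]
        rw [hC, hP]
        exact .rot A B Y'
      · have h4 : D = z ∧ C.toList = Z ++ (D :: (B.nest.toList ++ Y)) := by simpa using h2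
        obtain ⟨rfl, h4⟩ := h4
        -- the rotation takes place in `C`
        have hpre : (A.nest.toList).count U = (A.nest.toList).count D := A.nest.count_U_eq_count_D
        have h'' : P'.toList = A.nest.toList ++ (Z ++ B.nest.toList ++ [D] ++ Y) := by
          rw [h']; simp [nest_toList]
        obtain ⟨A', C', hA', hC'⟩ := P'.exists_of_append h'' hpre
        have hP : P' = A.nest + C' := by ext1; rw [h'', ← hC']; rfl
        rw [hP]
        exact .right A C C' (ihC C' ⟨Z, Y, B.nest, hn, by simp [h4], hC'⟩)
    · rcases Z with _ | ⟨z, Z⟩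
      · have h2 : C.toList = B.nest.toList ++ Y := by simpa using h2.symm
        have h1 : A.toList = X := by simpa using h1
        subst h1
        obtain ⟨B', Y', hB, rfl⟩ := C.exists_of_append h2 B.nest.count_U_eq_count_D
        have hC : C = B.nest + Y' := by ext1; exact h2
        have hP : P' = (A + B.nest).nest + Y' := by
          ext1; rw [h']; simp [add_toList, nest_toList]
        rw [hC, hP]
        exact .rot A B Y'
      · have h4 : D = z ∧ B.nest.toList ++ Y = Z ++ (D :: C.toList) := by simpa using h2
        obtain ⟨rfl, h4⟩ := h4
        rw [List.append_eq_append_iff] at h4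
        have hZ : Z.count U ≤ Z.count D :=
          A.suffix_count (X := X ++ [D]) (Y := Z) (by simp [h1])
        have key : ∃ T, Z = B.nest.toList ++ T ∧ Y = T ++ (D :: C.toList) := by
          rcases h4 with h4 | ⟨T, h4, h3⟩
          · exact h4
          · rcases T with _ | ⟨t, T⟩
            · exact ⟨[], by simpa using h4.symm, by simpa using h3.symm⟩
            · exfalso
              have h5 : D = t ∧ C.toList = T ++ Y := by simpa using h3
              obtain ⟨rfl, -⟩ := h5
              have := B.nest.count_D_le_count_U (Z.length + 1)
              rw [h4, List.take_length_add_append] at this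
              simp at this
              omega
        obtain ⟨T, rfl, rfl⟩ := key
        have hbal : (X ++ B.nest.toList ++ [D] ++ T).count U =
            (X ++ B.nest.toList ++ [D] ++ T).count D := by
          have := A.count_U_eq_count_D
          rw [h1] at this
          simp only [List.count_append, List.count_cons] at this ⊢
          simp at this ⊢
          omega
        have h'' : P'.toList = (U :: (X ++ B.nest.toList ++ [D] ++ T) ++ [D]) ++ C.toList := by
          rw [h']; simp
        have hle (i : ℕ) : ((X ++ B.nest.toList ++ [D] ++ T).take i).count D ≤
            ((X ++ B.nest.toList ++ [D] ++ T).take i).count U := by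
          rcases le_or_gt i (X.length + B.nest.toList.length) with hi | hi
          · rw [List.append_assoc, List.take_append_of_le_length (by simpa using hi)]
            rw [List.take_append, List.count_append, List.count_append]
            have e1 := A.count_D_le_count_U (min i X.length)
            rw [h1, List.take_append_of_le_length (by simp), ← List.take_take,
              List.take_length] at e1
            exact add_le_add e1 (B.nest.count_D_le_count_U _)
          · have e1 := A.count_D_le_count_U i
            obtain ⟨k, rfl⟩ : ∃ k, i = (X ++ [D] ++ B.nest.toList).length + k :=
              ⟨i - (X ++ [D] ++ B.nest.toList).length, by simp; omega⟩
            rw [h1, show X ++ D :: (B.nest.toList ++ T) = (X ++ [D] ++ B.nest.toList) ++ T by simp,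
              List.take_length_add_append] at e1
            rw [show (X ++ [D] ++ B.nest.toList).length = (X ++ B.nest.toList ++ [D]).length by
              simp, List.take_length_add_append]
            simp only [List.count_append] at e1 ⊢
            omega
        let A' : DyckWord := ⟨_, hbal, hle⟩
        have hP : P' = A'.nest + C := by ext1; exact h''
        rw [hP]
        exact .inside A A' C (ihA A' ⟨X, T, B.nest, hn, by simp [h1], rfl⟩)

theorem conjAux_mono (P : DyckWord) : ∀ {s s' : DyckWord}, TamariLE s s' →
    TamariLE (conjAux s P) (conjAux s' P) := by
  induction P using first_induction with
  | h0 => intro s s' h; simpa [conjAux_zero] using h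
  | h1 A C _ ih =>
    intro s s' h
    rw [conjAux_nest_add, conjAux_nest_add]
    exact ih ((TamariLE.refl _).add h.nest)

theorem Rot.conjAux {P P' : DyckWord} (h : Rot P P') :
    ∀ s, TamariLE (conjAux s P') (conjAux s P) := by
  induction h with
  | rot A B C =>
    intro s
    simp only [conjAux_nest_add, conj_add_nest]
    apply conjAux_mono
    rw [add_assoc]
    exact (TamariLE.refl _).add (TamariLE.rotate _ _)
  | inside A A' C _ ih =>
    intro s
    simp only [conjAux_nest_add]
    exact conjAux_mono _ ((ih 0).add (TamariLE.refl _))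
  | right A C C' _ ih =>
    intro s
    simp only [conjAux_nest_add]
    exact ih _

theorem TamariLE.conj {P Q : DyckWord} (h : TamariLE P Q) : TamariLE Q.conj P.conj := by
  induction h with
  | refl => exact TamariLE.refl _
  | tail _ h ih => exact ((rot_of_rightRotation _ _ h).conjAux 0).trans ih

theorem Rot.tamariLE {P P' : DyckWord} (h : Rot P P') : TamariLE P P' := by
  induction h with
  | rot A B C =>
    rw [← add_assoc]
    exact (TamariLE.rotate A B).add (TamariLE.refl C)
  | inside A A' C _ ih => exact ih.nest.add (TamariLE.refl C)
  | right A C C' _ ih => exact (TamariLE.refl _).add ih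

theorem Rot.split {P X : DyckWord} (h : Rot P X) : ∀ Y Z : DyckWord, X = Y + Z →
    ∃ Y' Z' : DyckWord, P = Y' + Z' ∧ TamariLE Y' Y ∧ TamariLE Z' Z := by
  induction h with
  | rot A B C =>
    intro Y Z e
    by_cases hY : Y = 0
    · subst hY
      exact ⟨0, _, (zero_add _).symm, TamariLE.refl _,
        (by rw [zero_add] at e; exact e ▸ (Rot.rot A B C).tamariLE)⟩
    · rw [← nest_insidePart_add_outsidePart hY, add_assoc] at e
      rw [← nest_insidePart_add_outsidePart hY]
      obtain ⟨e1, e2⟩ := nest_add_inj e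
      refine ⟨A.nest + (B.nest + Y.outsidePart), Z, by simp [e2, add_assoc], ?_, TamariLE.refl _⟩
      rw [← e1]
      exact (Rot.rot A B _).tamariLE
  | inside A A' C h _ =>
    intro Y Z e
    by_cases hY : Y = 0
    · subst hY
      exact ⟨0, _, (zero_add _).symm, TamariLE.refl _,
        (by rw [zero_add] at e; exact e ▸ (Rot.inside A A' C h).tamariLE)⟩
    · rw [← nest_insidePart_add_outsidePart hY, add_assoc] at e
      rw [← nest_insidePart_add_outsidePart hY]
      obtain ⟨e1, e2⟩ := nest_add_inj e
      refine ⟨A.nest + Y.outsidePart, Z, by simp [e2, add_assoc], ?_, TamariLE.refl _⟩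
      rw [← e1]
      exact h.tamariLE.nest.add (TamariLE.refl _)
  | right A C C' h ih =>
    intro Y Z e
    by_cases hY : Y = 0
    · subst hY
      exact ⟨0, _, (zero_add _).symm, TamariLE.refl _,
        (by rw [zero_add] at e; exact e ▸ (Rot.right A C C' h).tamariLE)⟩
    · rw [← nest_insidePart_add_outsidePart hY, add_assoc] at e
      rw [← nest_insidePart_add_outsidePart hY]
      obtain ⟨e1, e2⟩ := nest_add_inj e
      obtain ⟨Y', Z', h1, h2, h3⟩ := ih _ _ e2
      refine ⟨A.nest + Y', Z', by simp [h1, add_assoc], ?_, h3⟩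
      rw [← e1]
      exact (TamariLE.refl _).add h2

theorem TamariLE.decompose {P Q : DyckWord} (h : TamariLE P Q) (Q₁ Q₂ : DyckWord)
    (hQ : Q = Q₁.nest + Q₂) : ∃ L R P₂ : DyckWord, P = L.nest + R + P₂ ∧
      TamariLE (L + R) Q₁ ∧ TamariLE P₂ Q₂ := by
  induction h using Relation.ReflTransGen.head_induction_on with
  | refl => exact ⟨Q₁, 0, Q₂, by simpa using hQ, by simpa using TamariLE.refl Q₁, TamariLE.refl _⟩
  | head h _ ih =>
    obtain ⟨L, R, X, h1, h2, h3⟩ := ih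
    replace h := rot_of_rightRotation _ _ h
    rw [add_assoc] at h1
    generalize hW : L.nest + (R + X) = W at h1
    subst h1
    cases h with
    | rot A B C =>
      obtain ⟨rfl, rfl⟩ := nest_add_inj hW
      exact ⟨A, B.nest + R, X, by simp [add_assoc], by simpa [add_assoc] using h2, h3⟩
    | inside A A' C h =>
      obtain ⟨rfl, rfl⟩ := nest_add_inj hW
      exact ⟨A, R, X, by simp [add_assoc], (h.tamariLE.add (TamariLE.refl R)).trans h2, h3⟩
    | right A C C' h =>
      obtain ⟨rfl, rfl⟩ := nest_add_inj hW
      obtain ⟨R', X', rfl, h4, h5⟩ := h.split R X rfl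
      exact ⟨L, R', X', by simp [add_assoc], ((TamariLE.refl L).add h4).trans h2, h5.trans h3⟩

end DyckWord

/-- The letters of the words that encode extended fighting fish. -/
inductive FishLetter
  | E | N | W | S | V
  deriving DecidableEq

open FishLetter

/-- The words of the (non-empty) fighting fish: those obtained from the head `ENWS` by upper, lower
and double gluings. -/
inductive IsFightingFish : List FishLetter → Prop
  | head : IsFightingFish [E, N, W, S]
  | upper (X Y : List FishLetter) :
      IsFightingFish (X ++ [W] ++ Y) → IsFightingFish (X ++ [N, W, S] ++ Y)
  | lower (X Y : List FishLetter) :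
      IsFightingFish (X ++ [N] ++ Y) → IsFightingFish (X ++ [E, N, W] ++ Y)
  | double (X Y : List FishLetter) :
      IsFightingFish (X ++ [W, N] ++ Y) → IsFightingFish (X ++ [N, W] ++ Y)

/-- Replace every letter `V` by the factor `WN`. -/
def expandV (F : List FishLetter) : List FishLetter :=
  F.flatMap fun a => if a = V then [W, N] else [a]

/-- `F` is the empty fish `EVS` or is obtained from a fighting fish by replacing some (possibly
none) of its factors `WN` by `V`; the latter means that undoing these replacements gives a fighting
fish. -/
def IsExtendedFightingFish (F : List FishLetter) : Prop :=
  F = [E, V, S] ∨ IsFightingFish (expandV F)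

/-- Exchange `E` with `S`, and `N` with `W`. -/
def FishLetter.swap : FishLetter → FishLetter
  | E => S
  | S => E
  | N => W
  | W => N
  | V => V

namespace FishWord

/-- The jaw length: the number of letters `E` at the beginning, except for the empty fish `EVS`,
which has jaw length `0`. -/
def jaw (F : List FishLetter) : ℕ :=
  if F = [E, V, S] then 0 else (F.takeWhile (· = E)).length

/-- The concatenation: `G₁ S ⊙ E ^ j N G₂ = E ^ j G₁ G₂` where `j` is the jaw length of the second
word, and the empty fish is neutral. -/
def concat (F₁ F₂ : List FishLetter) : List FishLetter :=
  if F₁ = [E, V, S] then F₂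
  else if F₂ = [E, V, S] then F₁
  else List.replicate (jaw F₂) E ++ F₁.dropLast ++ F₂.drop (jaw F₂ + 1)

/-- The `i`-augmentation (for `1 ≤ i ≤ jaw F + 1`) of `F = E ^ j N G`, where `j = jaw F`: it is
`E ^ i N E ^ (j - i) N G S` if `i ≤ j` and `E ^ (j + 1) N V G S` if `i = j + 1`. The
`1`-augmentation of the empty fish is `ENWS`. -/
def augment (F : List FishLetter) (i : ℕ) : List FishLetter :=
  if F = [E, V, S] then [E, N, W, S]
  else if i ≤ jaw F then
    List.replicate i E ++ [N] ++ List.replicate (jaw F - i) E ++ [N] ++ F.drop (jaw F + 1) ++ [S]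
  else List.replicate (jaw F + 1) E ++ [N, V] ++ F.drop (jaw F + 1) ++ [S]

/-- The conjugate of a word: reverse it, and exchange `E` with `S` and `N` with `W`. -/
def conj (F : List FishLetter) : List FishLetter := F.reverse.map FishLetter.swap

theorem expandV_nil : expandV [] = [] := rfl

theorem expandV_append (X Y : List FishLetter) : expandV (X ++ Y) = expandV X ++ expandV Y := by
  simp [expandV]

theorem expandV_cons (a : FishLetter) (Y : List FishLetter) :
    expandV (a :: Y) = (if a = V then [W, N] else [a]) ++ expandV Y := by
  simp [expandV]

theorem expandV_replicate (n : ℕ) :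
    expandV (List.replicate n E) = List.replicate n E := by
  induction n with
  | zero => rfl
  | succ n ih => rw [List.replicate_succ, expandV_cons, ih]; rfl

/-- A letter other than `E` in a word `E ^ j N G` is this `N` or lies in `G`. -/
theorem locate {a : FishLetter} (ha : a ≠ E) {G Y : List FishLetter} (j : ℕ) :
    ∀ X : List FishLetter, X ++ a :: Y = List.replicate j E ++ N :: G →
      (X = List.replicate j E ∧ a = N ∧ Y = G) ∨
      ∃ X', X = List.replicate j E ++ N :: X' ∧ G = X' ++ a :: Y := by
  induction j with
  | zero =>
    intro X h
    cases X with
    | nil => left; simpa using h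
    | cons x X => right; simp at h; exact ⟨X, by simp [h.1], h.2.symm⟩
  | succ j ih =>
    intro X h
    cases X with
    | nil => simp [List.replicate_succ] at h; exact absurd h.1 ha
    | cons x X =>
      have h0 : x = E ∧ X ++ a :: Y = List.replicate j E ++ N :: G := by
        simpa [List.replicate_succ] using h
      obtain ⟨rfl, h0⟩ := h0
      rcases ih X h0 with ⟨rfl, h1⟩ | ⟨X', rfl, h1⟩
      · left; exact ⟨rfl, h1⟩
      · right; exact ⟨X', by simp [List.replicate_succ], h1⟩

theorem fish_start {F : List FishLetter} (h : IsFightingFish F) :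
    ∃ j G, 1 ≤ j ∧ F = List.replicate j E ++ N :: G := by
  induction h with
  | head => exact ⟨1, [W, S], le_rfl, rfl⟩
  | upper X Y _ ih =>
    obtain ⟨j, G, hj, h⟩ := ih
    rcases locate (a := W) (by decide) j X (by simpa using h) with ⟨_, h, _⟩ | ⟨X', rfl, _⟩
    · exact absurd h (by decide)
    · exact ⟨j, X' ++ [N, W, S] ++ Y, hj, by simp⟩
  | lower X Y _ ih =>
    obtain ⟨j, G, hj, h⟩ := ih
    rcases locate (a := N) (by decide) j X (by simpa using h) with ⟨rfl, _, _⟩ | ⟨X', rfl, _⟩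
    · exact ⟨j + 1, W :: Y, by omega, by simp [List.replicate_succ']⟩
    · exact ⟨j, X' ++ [E, N, W] ++ Y, hj, by simp⟩
  | double X Y _ ih =>
    obtain ⟨j, G, hj, h⟩ := ih
    rcases locate (a := W) (Y := N :: Y) (by decide) j X (by simpa using h) with
      ⟨_, h, _⟩ | ⟨X', rfl, _⟩
    · exact absurd h (by decide)
    · exact ⟨j, X' ++ [N, W] ++ Y, hj, by simp⟩

theorem fish_end {F : List FishLetter} (h : IsFightingFish F) : ∃ G, F = G ++ [S] := by
  have key (X Y Z : List FishLetter) (a : FishLetter) (ha : a ≠ S)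
      (h : ∃ G, X ++ [a] ++ Y = G ++ [S]) : ∃ G, X ++ Z ++ Y = G ++ [S] := by
    obtain ⟨G, h⟩ := h
    rcases List.eq_nil_or_concat Y with rfl | ⟨Y', y, rfl⟩
    · simp at h; exact absurd h.2 ha
    · rw [List.concat_eq_append, ← List.append_assoc] at h
      exact ⟨X ++ Z ++ Y', by simpa using (List.append_inj' h rfl).2⟩
  induction h with
  | head => exact ⟨[E, N, W], rfl⟩
  | upper X Y _ ih => exact key X Y _ W (by decide) ih
  | lower X Y _ ih => exact key X Y _ N (by decide) ih
  | double X Y _ ih =>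
    rw [show X ++ [W, N] ++ Y = X ++ [W] ++ [N] ++ Y by simp] at ih
    obtain ⟨G, h⟩ := key (X ++ [W]) Y [] N (by decide) ih
    rcases List.eq_nil_or_concat Y with rfl | ⟨Y', y, rfl⟩
    · simp at h
    · rw [List.concat_eq_append, ← List.append_assoc] at h
      exact ⟨X ++ [N, W] ++ Y', by simpa using (List.append_inj' h rfl).2⟩

theorem expandV_start (j : ℕ) : ∀ {F G : List FishLetter},
    expandV F = List.replicate j E ++ N :: G → ∃ G', F = List.replicate j E ++ N :: G' := by
  induction j with
  | zero =>
    intro F G h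
    cases F with
    | nil => simp [expandV] at h
    | cons a F => cases a <;> simp [expandV_cons] at h; exact ⟨F, rfl⟩
  | succ j ih =>
    intro F G h
    cases F with
    | nil => simp [expandV] at h
    | cons a F =>
      cases a <;> simp [expandV_cons, List.replicate_succ] at h
      obtain ⟨G', rfl⟩ := ih h
      exact ⟨G', by simp [List.replicate_succ]⟩

theorem expandV_end {F G : List FishLetter} (h : expandV F = G ++ [S]) :
    ∃ G', F = G' ++ [S] := by
  rcases List.eq_nil_or_concat F with rfl | ⟨F', a, rfl⟩
  · simp [expandV] at h
  · have := congrArg List.getLast? h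
    cases a <;> simp [expandV] at this
    exact ⟨F', by simp⟩

/-- Extended fighting fish other than the empty one are of the form `E ^ j N G` and `G' S`. -/
theorem shape {F : List FishLetter} (h : IsExtendedFightingFish F) (h0 : F ≠ [E, V, S]) :
    IsFightingFish (expandV F) ∧ ∃ j G G', 1 ≤ j ∧ F = List.replicate j E ++ N :: G ∧
      F = G' ++ [S] := by
  have h := h.resolve_left h0
  obtain ⟨j, G, hj, h1⟩ := fish_start h
  obtain ⟨G', h2⟩ := fish_end h
  obtain ⟨G, h3⟩ := expandV_start j h1
  obtain ⟨G', h4⟩ := expandV_end h2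
  exact ⟨h, j, G, G', hj, h3, h4⟩

theorem not_empty (j : ℕ) (G : List FishLetter) : List.replicate j E ++ N :: G ≠ [E, V, S] := by
  rcases j with _ | _ | j <;> simp [List.replicate_succ]

theorem jaw_eq (j : ℕ) (G : List FishLetter) : jaw (List.replicate j E ++ N :: G) = j := by
  rw [jaw, if_neg (not_empty j G), List.takeWhile_append]
  simp

theorem drop_eq (j : ℕ) (G : List FishLetter) :
    (List.replicate j E ++ N :: G).drop (j + 1) = G := by
  rw [← List.drop_drop, List.drop_left' (by simp)]
  rfl

theorem start_inj {j k : ℕ} {G H : List FishLetter}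
    (h : List.replicate j E ++ N :: G = List.replicate k E ++ N :: H) : j = k ∧ G = H := by
  obtain rfl : j = k := by rw [← jaw_eq j G, h, jaw_eq]
  exact ⟨rfl, by rw [← drop_eq j G, h, drop_eq]⟩

theorem fish_concat {j : ℕ} {G₂ F : List FishLetter}
    (h2 : IsFightingFish (List.replicate j E ++ N :: G₂)) (h1 : IsFightingFish F) :
    ∀ G₁, F = G₁ ++ [S] → IsFightingFish (List.replicate j E ++ G₁ ++ G₂) := by
  have key (X Y Z G₁ : List FishLetter) (hY : Y ≠ []) (h : X ++ Z ++ Y = G₁ ++ [S]) :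
      ∃ Y', Y = Y' ++ [S] ∧ G₁ = X ++ Z ++ Y' := by
    rcases List.eq_nil_or_concat Y with rfl | ⟨Y', y, rfl⟩
    · exact absurd rfl hY
    · rw [List.concat_eq_append, ← List.append_assoc] at h
      obtain ⟨h3, h4⟩ := List.append_inj' h rfl
      exact ⟨Y', by simpa using h4, h3.symm⟩
  have ne (X Y Z : List FishLetter) (a : FishLetter) (ha : a ≠ S)
      (h : IsFightingFish (X ++ Z ++ [a] ++ Y)) : Y ≠ [] := by
    rintro rfl
    obtain ⟨G, h⟩ := fish_end h
    have := congrArg List.getLast? h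
    simp at this
    exact ha this
  induction h1 with
  | head =>
    intro G₁ h
    obtain rfl : G₁ = [E, N, W] := by
      have := congrArg List.dropLast h
      simpa using this.symm
    exact .lower (List.replicate j E) G₂ (by simpa using h2)
  | upper X Y hf ih =>
    intro G₁ h
    obtain ⟨Y', rfl, rfl⟩ := key X Y _ G₁ (ne X Y [] W (by decide) (by simpa using hf)) h
    have := ih (X ++ [W] ++ Y') (by simp)
    simpa using IsFightingFish.upper (List.replicate j E ++ X) (Y' ++ G₂) (by simpa using this)
  | lower X Y hf ih =>
    intro G₁ h
    obtain ⟨Y', rfl, rfl⟩ := key X Y _ G₁ (ne X Y [] N (by decide) (by simpa using hf)) h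
    have := ih (X ++ [N] ++ Y') (by simp)
    simpa using IsFightingFish.lower (List.replicate j E ++ X) (Y' ++ G₂) (by simpa using this)
  | double X Y hf ih =>
    intro G₁ h
    obtain ⟨Y', rfl, rfl⟩ := key X Y _ G₁ (ne X Y [W] N (by decide) (by simpa using hf)) h
    have := ih (X ++ [W, N] ++ Y') (by simp)
    simpa using IsFightingFish.double (List.replicate j E ++ X) (Y' ++ G₂) (by simpa using this)

theorem concat_isFish {F₁ F₂ : List FishLetter} (h1 : IsExtendedFightingFish F₁)
    (h2 : IsExtendedFightingFish F₂) : IsExtendedFightingFish (concat F₁ F₂) := by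
  unfold concat
  split_ifs with e1 e2
  · exact h2
  · exact h1
  · obtain ⟨f1, -, -, G₁, -, -, rfl⟩ := shape h1 e1
    obtain ⟨f2, j, G₂, -, -, rfl, -⟩ := shape h2 e2
    rw [jaw_eq, drop_eq, List.dropLast_concat]
    right
    rw [expandV_append, expandV_append, expandV_replicate]
    refine fish_concat ?_ f1 _ ?_
    · simpa [expandV_append, expandV_cons, expandV_replicate] using f2
    · simp [expandV]

theorem fish_augment {F : List FishLetter} (h : IsFightingFish F) :
    ∀ j G i, F = List.replicate j E ++ N :: G → 1 ≤ i → i ≤ j →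
      IsFightingFish (List.replicate i E ++ [N] ++ List.replicate (j - i) E ++ [N] ++ G ++ [S]) := by
  induction h with
  | head =>
    intro j G i h hi hj
    obtain rfl : j = 1 := by rw [← jaw_eq j G, ← h]; rfl
    obtain rfl : i = 1 := by omega
    obtain rfl : G = [W, S] := by simpa [eq_comm] using h
    exact .upper [E, N] [S] .head
  | upper X Y hf ih =>
    intro j G i h hi hj
    obtain ⟨k, G₀, -, h0⟩ := fish_start hf
    rcases locate (a := W) (by decide) k X (by simpa using h0) with ⟨-, h1, -⟩ | ⟨X', rfl, -⟩
    · exact absurd h1 (by decide)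
    · obtain ⟨rfl, rfl⟩ := start_inj (k := j) (H := G)
        (j := k) (G := X' ++ [N, W, S] ++ Y) (by simpa using h)
      have := ih k (X' ++ [W] ++ Y) i (by simp) hi hj
      simpa using IsFightingFish.upper
        (List.replicate i E ++ [N] ++ List.replicate (k - i) E ++ [N] ++ X') (Y ++ [S])
        (by simpa using this)
  | lower X Y hf ih =>
    intro j G i h hi hj
    obtain ⟨k, G₀, hk, h0⟩ := fish_start hf
    rcases locate (a := N) (by decide) k X (by simpa using h0) with ⟨rfl, -, -⟩ | ⟨X', rfl, -⟩
    · obtain ⟨rfl, rfl⟩ := start_inj (k := j) (H := G)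
        (j := k + 1) (G := W :: Y) (by simpa [List.replicate_succ'] using h)
      rcases Nat.lt_or_ge k i with hik | hik
      · obtain rfl : i = k + 1 := by omega
        have h1 := ih k Y k (by simp) hk le_rfl
        have h2 := IsFightingFish.lower (List.replicate k E) ([N] ++ Y ++ [S]) (by simpa using h1)
        have h3 := IsFightingFish.double (List.replicate k E ++ [E, N]) (Y ++ [S])
          (by simpa using h2)
        simpa [List.replicate_succ'] using h3
      · have h1 := ih k Y i (by simp) hi hik
        have h2 := IsFightingFish.lower
          (List.replicate i E ++ [N] ++ List.replicate (k - i) E) (Y ++ [S]) (by simpa using h1)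
        rw [show k + 1 - i = (k - i) + 1 by omega]
        simpa [List.replicate_succ'] using h2
    · obtain ⟨rfl, rfl⟩ := start_inj (k := j) (H := G)
        (j := k) (G := X' ++ [E, N, W] ++ Y) (by simpa using h)
      have := ih k (X' ++ [N] ++ Y) i (by simp) hi hj
      simpa using IsFightingFish.lower
        (List.replicate i E ++ [N] ++ List.replicate (k - i) E ++ [N] ++ X') (Y ++ [S])
        (by simpa using this)
  | double X Y hf ih =>
    intro j G i h hi hj
    obtain ⟨k, G₀, -, h0⟩ := fish_start hf
    rcases locate (a := W) (Y := N :: Y) (by decide) k X (by simpa using h0) with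
      ⟨-, h1, -⟩ | ⟨X', rfl, -⟩
    · exact absurd h1 (by decide)
    · obtain ⟨rfl, rfl⟩ := start_inj (k := j) (H := G)
        (j := k) (G := X' ++ [N, W] ++ Y) (by simpa using h)
      have := ih k (X' ++ [W, N] ++ Y) i (by simp) hi hj
      simpa using IsFightingFish.double
        (List.replicate i E ++ [N] ++ List.replicate (k - i) E ++ [N] ++ X') (Y ++ [S])
        (by simpa using this)

theorem augment_isFish {F : List FishLetter} (h : IsExtendedFightingFish F) {i : ℕ}
    (hi : 1 ≤ i) : IsExtendedFightingFish (augment F i) := by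
  unfold augment
  split_ifs with e1 e2
  · exact .inr .head
  · obtain ⟨f, j, G, -, -, rfl, -⟩ := shape h e1
    rw [jaw_eq] at *
    rw [drop_eq]
    right
    have := fish_augment f j (expandV G) i
      (by simp [expandV_append, expandV_cons, expandV_replicate]) hi e2
    simpa [expandV_append, expandV_cons, expandV_replicate, expandV_nil] using this
  · obtain ⟨f, j, G, -, hj, rfl, -⟩ := shape h e1
    rw [jaw_eq] at *
    rw [drop_eq]
    right
    have := fish_augment f j (expandV G) j
      (by simp [expandV_append, expandV_cons, expandV_replicate]) hj le_rfl
    have := IsFightingFish.lower (List.replicate j E) ([N] ++ expandV G ++ [S])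
      (by simpa using this)
    simpa [expandV_append, expandV_cons, expandV_replicate, expandV_nil,
      List.replicate_succ'] using this

theorem conj_expandV (F : List FishLetter) : expandV (conj F) = conj (expandV F) := by
  induction F with
  | nil => rfl
  | cons a F ih =>
    have : conj (a :: F) = conj F ++ [a.swap] := by simp [conj]
    rw [this, expandV_append, ih, expandV_cons]
    cases a <;> simp [conj, expandV, FishLetter.swap]

theorem conj_isFightingFish {F : List FishLetter} (h : IsFightingFish F) :
    IsFightingFish (conj F) := by
  induction h with
  | head => exact .head
  | upper X Y _ ih =>
    simpa [conj, FishLetter.swap] using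
      IsFightingFish.lower (conj Y) (conj X) (by simpa [conj, FishLetter.swap] using ih)
  | lower X Y _ ih =>
    simpa [conj, FishLetter.swap] using
      IsFightingFish.upper (conj Y) (conj X) (by simpa [conj, FishLetter.swap] using ih)
  | double X Y _ ih =>
    simpa [conj, FishLetter.swap] using
      IsFightingFish.double (conj Y) (conj X) (by simpa [conj, FishLetter.swap] using ih)

theorem conj_isFish {F : List FishLetter} (h : IsExtendedFightingFish F) :
    IsExtendedFightingFish (conj F) := by
  rcases h with rfl | h
  · exact .inl rfl
  · exact .inr (by rw [conj_expandV]; exact conj_isFightingFish h)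

theorem jaw_concat {F₁ F₂ : List FishLetter} (h1 : IsExtendedFightingFish F₁)
    (h2 : IsExtendedFightingFish F₂) : jaw (concat F₁ F₂) = jaw F₁ + jaw F₂ := by
  have h0 : jaw [E, V, S] = 0 := rfl
  unfold concat
  split_ifs with e1 e2
  · rw [e1, h0, zero_add]
  · rw [e2, h0, add_zero]
  · obtain ⟨f1, j₁, G, G₁, -, e, e'⟩ := shape h1 e1
    obtain ⟨f2, j, G₂, -, -, rfl, -⟩ := shape h2 e2
    rw [jaw_eq, drop_eq]
    have hG : ∃ G', G = G' ++ [S] := by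
      rcases List.eq_nil_or_concat G with rfl | ⟨G', y, rfl⟩
      · rw [e] at e'
        exact absurd (List.append_inj' e' rfl).2 (by decide)
      · rw [e, List.concat_eq_append, ← List.cons_append, ← List.append_assoc] at e'
        exact ⟨G', by simpa using (List.append_inj' e' rfl).2⟩
    obtain ⟨G', rfl⟩ := hG
    subst e
    rw [jaw_eq, ← List.cons_append, ← List.append_assoc, List.dropLast_concat,
      show List.replicate j E ++ (List.replicate j₁ E ++ N :: G') ++ G₂ =
        List.replicate (j₁ + j) E ++ N :: (G' ++ G₂) by
        rw [add_comm, List.replicate_add, List.append_assoc, List.append_assoc, List.append_assoc]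
        rfl, jaw_eq]

theorem jaw_augment {F : List FishLetter} {i : ℕ} (hi : 1 ≤ i) (h : i ≤ jaw F + 1) :
    jaw (augment F i) = i := by
  unfold augment
  split_ifs with e1 e2
  · subst e1
    have h0 : jaw [E, V, S] = 0 := rfl
    obtain rfl : i = 1 := by omega
    rfl
  · simp only [List.append_assoc, List.singleton_append]
    exact jaw_eq _ _
  · obtain rfl : i = jaw F + 1 := by omega
    simp only [List.append_assoc, List.cons_append]
    exact jaw_eq _ _

end FishWord

/-- The extended fighting fish. -/
@[ext]
structure ExtendedFightingFish where
  word : List FishLetter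
  isFish : IsExtendedFightingFish word

namespace ExtendedFightingFish

/-- The empty fish `EVS`. -/
def empty : ExtendedFightingFish := ⟨[E, V, S], .inl rfl⟩

/-- The jaw length. -/
def jaw (F : ExtendedFightingFish) : ℕ := FishWord.jaw F.word

/-- The conjugate, i.e. the image under the symmetry with respect to the horizontal axis. -/
def conj (F : ExtendedFightingFish) : ExtendedFightingFish :=
  ⟨FishWord.conj F.word, FishWord.conj_isFish F.isFish⟩

/-- The concatenation of two extended fighting fish. -/
def concat (F₁ F₂ : ExtendedFightingFish) : ExtendedFightingFish :=
  ⟨FishWord.concat F₁.word F₂.word, FishWord.concat_isFish F₁.isFish F₂.isFish⟩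

/-- A pointed extended fighting fish: its first `index` free left lower edges are distinguished,
where `1 ≤ index ≤ jaw + 1`. -/
structure Pointed where
  fish : ExtendedFightingFish
  index : ℕ
  one_le_index : 1 ≤ index
  index_le : index ≤ fish.jaw + 1

/-- The augmentation of a pointed extended fighting fish. -/
def Pointed.augment (F : Pointed) : ExtendedFightingFish :=
  ⟨FishWord.augment F.fish.word F.index, FishWord.augment_isFish F.fish.isFish F.one_le_index⟩

/-- The low composition of a pointed extended fighting fish and an extended fighting fish. -/
def lowComposition (F₁ : Pointed) (F₂ : ExtendedFightingFish) : ExtendedFightingFish :=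
  F₁.augment.concat F₂

theorem jaw_lowComposition (F₁ : Pointed) (F₂ : ExtendedFightingFish) :
    (lowComposition F₁ F₂).jaw = F₁.index + F₂.jaw := by
  unfold lowComposition concat jaw
  rw [FishWord.jaw_concat F₁.augment.isFish F₂.isFish]
  congr 1
  exact FishWord.jaw_augment F₁.one_le_index F₁.index_le

end ExtendedFightingFish

/-- The Tamari intervals `[lower, upper]`. -/
@[ext]
structure TamariInterval where
  lower : DyckWord
  upper : DyckWord
  le : lower.TamariLE upper

namespace TamariInterval

/-- The size: the common size of the two Dyck paths. -/
def size (I : TamariInterval) : ℕ := I.lower.semilength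

/-- The interval `[•, •]` of size `0`. -/
def empty : TamariInterval := ⟨0, 0, DyckWord.TamariLE.refl 0⟩

/-- The conjugate `[conj Q, conj P]` of `[P, Q]`. -/
def conj (I : TamariInterval) : TamariInterval := ⟨I.upper.conj, I.lower.conj, I.le.conj⟩

/-- The concatenation `[P₁ P₂, Q₁ Q₂]` of `[P₁, Q₁]` and `[P₂, Q₂]`. -/
def concat (I₁ I₂ : TamariInterval) : TamariInterval :=
  ⟨I₁.lower + I₂.lower, I₁.upper + I₂.upper, I₁.le.add I₂.le⟩

/-- A pointed Tamari interval: a contact of the lower path is distinguished, which splits the lower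
path into two (possibly empty) Dyck paths. -/
@[ext]
structure Pointed where
  interval : TamariInterval
  left : DyckWord
  right : DyckWord
  split : interval.lower = left + right

/-- The index of the distinguished contact, where the contacts of the lower path (including the
initial one) are counted from right to left, starting with `1`. -/
def Pointed.index (I : Pointed) : ℕ := I.right.contacts + 1

theorem Pointed.index_le (I : Pointed) : I.index ≤ I.interval.lower.contacts + 1 := by
  rw [I.split, DyckWord.contacts_add, index]
  omega

/-- The augmentation `[u L d R, u Q d]` of the pointed interval `[L · R, Q]`. -/
def Pointed.augment (I : Pointed) : TamariInterval :=
  ⟨I.left.nest + I.right, I.interval.upper.nest,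
    (DyckWord.TamariLE.nest_add _ _).trans (I.split ▸ I.interval.le.nest)⟩

/-- The left composition of a pointed Tamari interval and a Tamari interval. -/
def leftComposition (I₁ : Pointed) (I₂ : TamariInterval) : TamariInterval :=
  I₁.augment.concat I₂

theorem contacts_leftComposition (I₁ : Pointed) (I₂ : TamariInterval) :
    (leftComposition I₁ I₂).lower.contacts = I₁.index + I₂.lower.contacts := by
  simp only [leftComposition, concat, Pointed.augment, DyckWord.contacts_add,
    DyckWord.contacts_nest, Pointed.index]
  omega

theorem size_leftComposition (I₁ : Pointed) (I₂ : TamariInterval) :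
    (leftComposition I₁ I₂).size = I₁.interval.size + I₂.size + 1 := by
  simp only [leftComposition, concat, Pointed.augment, size, I₁.split,
    DyckWord.semilength_add, DyckWord.semilength_nest]
  omega

theorem eq_empty {I : TamariInterval} (h : I.size = 0) : I = empty := by
  have key (P : DyckWord) (hP : P.semilength = 0) : P = 0 := by
    by_contra h0
    have := DyckWord.semilength_insidePart_lt h0
    omega
  ext1
  · exact key _ h
  · exact key _ (I.le.semilength_eq ▸ h)

theorem exists_leftComposition (I : TamariInterval) (h : I ≠ empty) :
    ∃ p : Pointed × TamariInterval, leftComposition p.1 p.2 = I := by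
  have h0 : I.upper ≠ 0 := fun e => h (eq_empty (by
    rw [size, I.le.semilength_eq, e]; rfl))
  have e := DyckWord.nest_insidePart_add_outsidePart h0
  obtain ⟨L, R, P₂, h1, h2, h3⟩ := I.le.decompose _ _ e.symm
  exact ⟨(⟨⟨L + R, _, h2⟩, L, R, rfl⟩, ⟨P₂, _, h3⟩), TamariInterval.ext h1.symm e⟩

theorem leftComposition_inj {I₁ J₁ : Pointed} {I₂ J₂ : TamariInterval}
    (h : leftComposition I₁ I₂ = leftComposition J₁ J₂) : I₁ = J₁ ∧ I₂ = J₂ := by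
  have hu := congrArg upper h
  have hl := congrArg lower h
  simp only [leftComposition, concat, Pointed.augment] at hu hl
  obtain ⟨hu1, hu2⟩ := DyckWord.nest_add_inj hu
  have hs : I₂.lower.toList.length = J₂.lower.toList.length := by
    rw [← DyckWord.two_mul_semilength_eq_length, ← DyckWord.two_mul_semilength_eq_length,
      I₂.le.semilength_eq, J₂.le.semilength_eq, hu2]
  obtain ⟨h1, h2⟩ := List.append_inj' (congrArg DyckWord.toList hl) hs
  obtain ⟨h3, h4⟩ := DyckWord.nest_add_inj (DyckWord.ext h1)
  exact ⟨Pointed.ext (TamariInterval.ext (by rw [I₁.split, J₁.split, h3, h4]) hu1) h3 h4,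
    TamariInterval.ext (DyckWord.ext h2) hu2⟩

open Classical in
/-- The recursive construction of the bijection from Tamari intervals to extended fighting fish,
together with the fact that the jaw length of the image is the number of non-initial contacts of
the lower path, so that both sides can be pointed by the same indices. -/
noncomputable def phiAux (I : TamariInterval) :
    {F : ExtendedFightingFish // F.jaw = I.lower.contacts} :=
  if h : I = empty then ⟨.empty, by rw [h]; rfl⟩
  else
    let p := (I.exists_leftComposition h).choose
    have hp : leftComposition p.1 p.2 = I := (I.exists_leftComposition h).choose_spec
    have hs : p.1.interval.size + p.2.size + 1 = I.size := by rw [← size_leftComposition, hp]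
    let F₁ := phiAux p.1.interval
    let F₂ := phiAux p.2
    ⟨.lowComposition ⟨F₁.1, p.1.index, Nat.le_add_left 1 _, by
        rw [F₁.2]; exact p.1.index_le⟩ F₂.1, by
      rw [ExtendedFightingFish.jaw_lowComposition, F₂.2, ← contacts_leftComposition, hp]⟩
termination_by I.size
decreasing_by
  · change p.1.interval.size < I.size
    omega
  · change p.2.size < I.size
    omega

/-- The bijection `Φ` from Tamari intervals to extended fighting fish. It is the map characterized
by `phi_empty` and `phi_leftComposition` below. -/
noncomputable def phi (I : TamariInterval) : ExtendedFightingFish := I.phiAux.1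

theorem jaw_phi (I : TamariInterval) : I.phi.jaw = I.lower.contacts := I.phiAux.2

theorem phi_empty : phi empty = .empty := by
  rw [phi, phiAux, dif_pos rfl]

theorem leftComposition_ne_empty (I₁ : Pointed) (I₂ : TamariInterval) :
    leftComposition I₁ I₂ ≠ empty := by
  intro h
  have := congrArg size h
  rw [size_leftComposition] at this
  exact absurd this (Nat.succ_ne_zero _)

/-- Pointing the image of a pointed interval by the same index. -/
noncomputable def Pointed.phi (I : Pointed) : ExtendedFightingFish.Pointed :=
  ⟨I.interval.phi, I.index, Nat.le_add_left 1 _, by rw [jaw_phi]; exact I.index_le⟩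

theorem phi_leftComposition (I₁ : Pointed) (I₂ : TamariInterval) :
    (leftComposition I₁ I₂).phi = .lowComposition I₁.phi I₂.phi := by
  have h := leftComposition_ne_empty I₁ I₂
  obtain ⟨h1, h2⟩ := leftComposition_inj (exists_leftComposition _ h).choose_spec
  have key (p : Pointed × TamariInterval) (h1 : p.1 = I₁) (h2 : p.2 = I₂) :
      ExtendedFightingFish.lowComposition p.1.phi p.2.phi = .lowComposition I₁.phi I₂.phi := by
    rw [h1, h2]
  rw [← key _ h1 h2]
  conv_lhs => rw [TamariInterval.phi, phiAux, dif_neg h]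
  rfl

theorem phi_unique (f : TamariInterval → ExtendedFightingFish) (h0 : f empty = .empty)
    (h1 : ∀ I₁ I₂, ∀ F₁ : ExtendedFightingFish.Pointed, F₁.fish = f I₁.interval →
      F₁.index = I₁.index → f (leftComposition I₁ I₂) = .lowComposition F₁ (f I₂))
    (I : TamariInterval) : f I = I.phi := by
  by_cases h : I = empty
  · rw [h, h0, phi_empty]
  · obtain ⟨⟨I₁, I₂⟩, hI⟩ := I.exists_leftComposition h
    have hs : I₁.interval.size + I₂.size + 1 = I.size := by rw [← size_leftComposition, hI]
    rw [← hI, phi_leftComposition, ← phi_unique f h0 h1 I₂,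
      h1 I₁ I₂ I₁.phi (phi_unique f h0 h1 I₁.interval).symm rfl]
termination_by I.size

end TamariInterval

/-!
The map `Φ` is built from two operations on Tamari intervals, the concatenation and the augmentation
of a pointed interval, which it turns into the concatenation and the augmentation of fish. The idea
for the conjugation is that `Φ` also respects the two operations obtained from these by conjugation.
Since every non-empty interval is `I.augment.concat J` for smaller `I` and `J`, the identity
`Conj (Φ I) = Φ (Conj I)` (`TamariInterval.conj_phi`) then follows by induction.

On Dyck paths, concatenation is conjugate to `DyckWord.graft`: `conj (A + B)` is `conj B` with
`conj A` inserted at its last peak (`DyckWord.conj_add`). Hence the conjugate of concatenating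
intervals is grafting both paths, and the conjugate of augmenting inserts a peak `u d` into the last
descent of the upper path and appends `u d` to the lower path. On fish, every non-empty word has the
form `FishWord.block j X m = E ^ (j + 1) N X W S ^ (m + 1)`: concatenation and augmentation change
the word only near its initial run `E ^ (j + 1) N` and at its final `S`, their conjugates only near
its final run `W S ^ (m + 1)` and at its initial `E`. The operations at the two ends commute
(`FishWord.graft_concat`, `FishWord.graft_augment`, `FishWord.coaugment_concat`,
`FishWord.coaugment_augment`). The same relations hold for intervals, and so two inductions along the
decomposition of intervals show that `Φ` respects the conjugate operations
(`TamariInterval.phi_word_graft`, `TamariInterval.phi_word_coaugment`).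

The letter counts follow by induction along the same decomposition
(`TamariInterval.hasLetterCounts`). The case that matters is the one where the left part of the
pointed lower path is empty: there the augmentation adds a valley instead of a double rise to the
lower path, and a letter `E` (together with a `V`) instead of a letter `N` to the fish.
-/

/-! ### Grafting and conjugation of Dyck paths -/

namespace DyckWord

theorem add_ne_zero_right {A C : DyckWord} (h : C ≠ 0) : A + C ≠ 0 := by
  intro e
  have := congrArg toList e
  rw [add_toList, show (0 : DyckWord).toList = [] from rfl, List.append_eq_nil_iff] at this
  exact h (DyckWord.ext this.2)

/-- `graft s P` is `P` with `s` inserted at its last peak, between the last `u` and the `d` that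
follows it; if `P` is empty, it is `s`. Grafting mirrors concatenation under conjugation, see
`conj_add`. -/
def graft (s P : DyckWord) : DyckWord :=
  if _h : P = 0 then s
  else if P.outsidePart = 0 then (graft s P.insidePart).nest
  else P.insidePart.nest + graft s P.outsidePart
termination_by P.semilength
decreasing_by exacts [semilength_insidePart_lt _h, semilength_outsidePart_lt _h]

theorem graft_zero_right (s : DyckWord) : graft s 0 = s := by rw [graft]; simp

theorem graft_nest (s A : DyckWord) : graft s A.nest = (graft s A).nest := by
  rw [graft, dif_neg nest_ne_zero]
  simp

theorem graft_nest_add (s A : DyckWord) {C : DyckWord} (h : C ≠ 0) :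
    graft s (A.nest + C) = A.nest + graft s C := by
  rw [graft, dif_neg (nest_add_ne_zero A C)]
  simp [h]

/-- Induction along the first-return decomposition, where the case of a single component is
separated from the case of several. -/
theorem component_induction {p : DyckWord → Prop} (h0 : p 0) (h1 : ∀ A, p A → p A.nest)
    (h2 : ∀ A C, C ≠ 0 → p A → p C → p (A.nest + C)) (P : DyckWord) : p P := by
  induction P using first_induction with
  | h0 => exact h0
  | h1 A C hA hC =>
    by_cases h : C = 0
    · subst h; simpa using h1 A hA
    · exact h2 A C h hA hC

theorem graft_add (s A : DyckWord) {C : DyckWord} (h : C ≠ 0) :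
    graft s (A + C) = A + graft s C := by
  induction A using first_induction with
  | h0 => simp
  | h1 A B _ ih => rw [add_assoc, graft_nest_add _ _ (add_ne_zero_right h), ih, add_assoc]

theorem graft_ne_zero (s : DyckWord) {P : DyckWord} (h : P ≠ 0) : graft s P ≠ 0 := by
  induction P using component_induction with
  | h0 => exact absurd rfl h
  | h1 A _ => rw [graft_nest]; exact nest_ne_zero
  | h2 A C hC _ _ => rw [graft_nest_add _ _ hC]; exact nest_add_ne_zero _ _

theorem graft_graft (s t P : DyckWord) : graft s (graft t P) = graft (graft s t) P := by
  induction P using component_induction with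
  | h0 => simp only [graft_zero_right]
  | h1 A ih => simp only [graft_nest, ih]
  | h2 A C hC _ ih =>
    rw [graft_nest_add _ _ hC, graft_nest_add _ _ hC, graft_nest_add _ _ (graft_ne_zero t hC), ih]

/-- The accumulator `s` of `conjAux` is inserted at the last peak of the conjugate. -/
theorem conjAux_eq_graft (P : DyckWord) : ∀ s, conjAux s P = graft s (conj P) := by
  induction P using first_induction with
  | h0 => intro s; rw [conj_zero, conjAux_zero, graft_zero_right]
  | h1 A C _ ih =>
    intro s
    rw [conj, conjAux_nest_add, conjAux_nest_add, ih, ih, graft_graft,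
      graft_add _ _ nest_ne_zero, graft_nest, graft_zero_right]

theorem conj_add (A B : DyckWord) : conj (A + B) = graft (conj A) (conj B) := by
  rw [conj, conjAux_add, conjAux_eq_graft]
  rfl

theorem conj_nest (A : DyckWord) : conj A.nest = conj A + nest 0 := by
  simpa [conj_zero] using conj_add_nest 0 A

theorem conj_ne_zero {P : DyckWord} (h : P ≠ 0) : conj P ≠ 0 := by
  induction P using component_induction with
  | h0 => exact absurd rfl h
  | h1 A _ => rw [conj_nest]; exact add_ne_zero_right nest_ne_zero
  | h2 A C hC _ ih => rw [conj_add]; exact graft_ne_zero _ (ih hC)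

theorem conj_graft (s P : DyckWord) : conj (graft s P) = conj s + conj P := by
  induction P using component_induction with
  | h0 => simp [graft_zero_right, conj_zero]
  | h1 A ih => rw [graft_nest, conj_nest, conj_nest, ih, add_assoc]
  | h2 A C hC _ ih =>
    rw [graft_nest_add _ _ hC, conj_add, conj_add, ih, graft_add _ _ (conj_ne_zero hC)]

theorem conj_conj (P : DyckWord) : conj (conj P) = P := by
  induction P using first_induction with
  | h0 => rw [conj_zero, conj_zero]
  | h1 A C hA hC =>
    rw [conj_add, conj_graft, hC, conj_nest, conj_add_nest, hA, conj_zero, zero_add]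

theorem contacts_nest_add (A C : DyckWord) : contacts (A.nest + C) = contacts C + 1 := by
  rw [contacts_add, contacts_nest, add_comm]

theorem contacts_graft (s : DyckWord) {P : DyckWord} (h : P ≠ 0) :
    contacts (graft s P) = contacts P := by
  induction P using component_induction with
  | h0 => exact absurd rfl h
  | h1 A _ => rw [graft_nest, contacts_nest, contacts_nest]
  | h2 A C hC _ ih => rw [graft_nest_add _ _ hC, contacts_nest_add, contacts_nest_add, ih hC]

theorem Rot.ne_zero {P P' : DyckWord} (h : Rot P P') : P ≠ 0 ∧ P' ≠ 0 := by
  cases h <;> exact ⟨nest_add_ne_zero _ _, nest_add_ne_zero _ _⟩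

/-- Grafting a fixed path respects rotations. If a rotation merges the last two components, its
image is again a rotation, of the components with `s` grafted onto the last. -/
theorem Rot.graft {P P' : DyckWord} (h : Rot P P') (s : DyckWord) :
    TamariLE (graft s P) (graft s P') := by
  induction h with
  | rot A B C =>
    by_cases hC : C = 0
    · subst hC
      rw [add_zero, add_zero, graft_nest_add _ _ nest_ne_zero, graft_nest, graft_nest,
        graft_add _ _ nest_ne_zero, graft_nest]
      exact TamariLE.rotate _ _
    · rw [graft_nest_add _ _ (nest_add_ne_zero B C), graft_nest_add _ _ hC, graft_nest_add _ _ hC,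
        ← add_assoc]
      exact (TamariLE.rotate A B).add (TamariLE.refl _)
  | inside A A' C h ih =>
    by_cases hC : C = 0
    · subst hC
      rw [add_zero, add_zero, graft_nest, graft_nest]
      exact ih.nest
    · rw [graft_nest_add _ _ hC, graft_nest_add _ _ hC]
      exact h.tamariLE.nest.add (TamariLE.refl _)
  | right A C C' h ih =>
    rw [graft_nest_add _ _ h.ne_zero.1, graft_nest_add _ _ h.ne_zero.2]
    exact (TamariLE.refl _).add ih

theorem graft_mono_left {s s' : DyckWord} (h : TamariLE s s') (P : DyckWord) :
    TamariLE (graft s P) (graft s' P) := by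
  induction P using component_induction with
  | h0 => simpa only [graft_zero_right] using h
  | h1 A ih => simpa only [graft_nest] using ih.nest
  | h2 A C hC _ ih =>
    rw [graft_nest_add _ _ hC, graft_nest_add _ _ hC]
    exact (TamariLE.refl _).add ih

theorem TamariLE.graft {s s' P P' : DyckWord} (hs : TamariLE s s') (h : TamariLE P P') :
    TamariLE (graft s P) (graft s' P') := by
  refine TamariLE.trans ?_ (graft_mono_left hs P')
  induction h with
  | refl => exact TamariLE.refl _
  | tail _ h ih => exact ih.trans ((rot_of_rightRotation _ _ h).graft s)

theorem graft_add_le (s t P : DyckWord) : TamariLE (graft s P + t) (graft (s + t) P) := by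
  induction P using component_induction with
  | h0 => simpa only [graft_zero_right] using TamariLE.refl _
  | h1 A ih =>
    rw [graft_nest, graft_nest]
    exact (TamariLE.nest_add _ _).trans ih.nest
  | h2 A C hC _ ih =>
    rw [graft_nest_add _ _ hC, graft_nest_add _ _ hC, add_assoc]
    exact (TamariLE.refl _).add ih

/-! ### Valleys and double rises -/

theorem exists_toList_eq_cons {P : DyckWord} (h : P ≠ 0) : ∃ X, P.toList = U :: X := by
  rw [← nest_insidePart_add_outsidePart h]
  exact ⟨_, by rw [add_toList, nest_toList, List.cons_append, List.cons_append]⟩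

theorem exists_toList_eq_concat {P : DyckWord} (h : P ≠ 0) : ∃ X, P.toList = X ++ [D] := by
  induction P using component_induction with
  | h0 => exact absurd rfl h
  | h1 A _ => exact ⟨_, nest_toList A⟩
  | h2 A C hC _ ih =>
    obtain ⟨X, hX⟩ := ih hC
    exact ⟨A.nest.toList ++ X, by rw [add_toList, hX, List.append_assoc]⟩

/-- The adjacent pairs of a concatenation: those of the two parts, and the pair at the junction. -/
theorem zip_tail_append {α : Type*} (X : List α) (a b : α) (Y : List α) :
    (X ++ [a] ++ b :: Y).zip (X ++ [a] ++ b :: Y).tail =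
      (X ++ [a]).zip (X ++ [a]).tail ++ (a, b) :: (b :: Y).zip Y := by
  induction X with
  | nil => simp
  | cons x X ih => cases X <;> simp_all

theorem val_add {P Q : DyckWord} (hP : P ≠ 0) (hQ : Q ≠ 0) :
    val (P + Q) = val P + val Q + 1 := by
  obtain ⟨X, hX⟩ := exists_toList_eq_concat hP
  obtain ⟨Y, hY⟩ := exists_toList_eq_cons hQ
  unfold val
  rw [add_toList, hX, hY, zip_tail_append]
  simp [List.count_append, add_assoc]

theorem doubleRises_add (P Q : DyckWord) :
    doubleRises (P + Q) = doubleRises P + doubleRises Q := by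
  by_cases hP : P = 0
  · subst hP; simp [doubleRises, show (0 : DyckWord).toList = [] from rfl]
  by_cases hQ : Q = 0
  · subst hQ; simp [doubleRises, show (0 : DyckWord).toList = [] from rfl]
  obtain ⟨X, hX⟩ := exists_toList_eq_concat hP
  obtain ⟨Y, hY⟩ := exists_toList_eq_cons hQ
  unfold doubleRises
  rw [add_toList, hX, hY, zip_tail_append]
  simp [List.count_append]

theorem zip_tail_nest {P : DyckWord} (h : P ≠ 0) :
    P.nest.toList.zip P.nest.toList.tail =
      (U, U) :: (P.toList.zip P.toList.tail ++ [(D, D)]) := by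
  obtain ⟨X, hX⟩ := exists_toList_eq_concat h
  obtain ⟨Y, hY⟩ := exists_toList_eq_cons h
  have h1 := zip_tail_append (U :: X) D D []
  have h2 := zip_tail_append [] U U Y
  rw [nest_toList, show U :: P.toList ++ [D] = U :: X ++ [D] ++ D :: [] by simp [hX], h1,
    show U :: X ++ [D] = [] ++ [U] ++ U :: Y by simp [← hX, hY], h2, hY]
  simp

theorem val_nest (P : DyckWord) : val P.nest = val P := by
  by_cases h : P = 0
  · subst h; rfl
  · rw [val, zip_tail_nest h]
    simp [List.count_append, val]

theorem doubleRises_nest {P : DyckWord} (h : P ≠ 0) : doubleRises P.nest = doubleRises P + 1 := by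
  rw [doubleRises, zip_tail_nest h]
  simp [List.count_append, doubleRises]

end DyckWord

/-! ### Fish operations in normal form -/

namespace FishWord

/-- The general form `E ^ (j + 1) N X W S ^ (m + 1)` of a non-empty extended fighting fish. The
concatenation, the augmentations and the conjugation act on it by explicit formulas. -/
def block (j : ℕ) (X : List FishLetter) (m : ℕ) : List FishLetter :=
  List.replicate (j + 1) E ++ N :: (X ++ W :: List.replicate (m + 1) S)

theorem conj_append (X Y : List FishLetter) : conj (X ++ Y) = conj Y ++ conj X := by
  simp [conj]

theorem conj_cons (a : FishLetter) (X : List FishLetter) :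
    conj (a :: X) = conj X ++ [a.swap] := by
  simp [conj]

theorem conj_conj (F : List FishLetter) : conj (conj F) = F := by
  have h : FishLetter.swap ∘ FishLetter.swap = id := by
    funext a; cases a <;> rfl
  simp [conj, h]

theorem conj_replicate (a : FishLetter) (n : ℕ) :
    conj (List.replicate n a) = List.replicate n a.swap := by
  simp [conj]

theorem conj_block (j : ℕ) (X : List FishLetter) (m : ℕ) :
    conj (block j X m) = block m (conj X) j := by
  simp [block, conj_append, conj_cons, conj_replicate, FishLetter.swap]

theorem block_ne (j : ℕ) (X : List FishLetter) (m : ℕ) : block j X m ≠ [E, V, S] :=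
  not_empty _ _

theorem jaw_block (j : ℕ) (X : List FishLetter) (m : ℕ) : jaw (block j X m) = j + 1 :=
  jaw_eq _ _

theorem drop_block (j : ℕ) (X : List FishLetter) (m : ℕ) :
    (block j X m).drop (j + 2) = X ++ W :: List.replicate (m + 1) S :=
  drop_eq _ _

/-- The initial run `E ^ j N` is read off `F`, the final run `W S ^ m` off its conjugate; the two
do not overlap because `N ≠ W`. -/
theorem exists_block {F : List FishLetter} (h : IsExtendedFightingFish F) :
    F = [E, V, S] ∨ ∃ j X m, F = block j X m := by
  by_cases h0 : F = [E, V, S]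
  · exact .inl h0
  right
  obtain ⟨-, j, G, -, hj, hF, -⟩ := shape h h0
  have h0' : conj F ≠ [E, V, S] := fun e => h0 (by rw [← conj_conj F, e]; rfl)
  obtain ⟨-, m, H, -, hm, hF', -⟩ := shape (conj_isFish h) h0'
  have e : conj H ++ W :: List.replicate m S = List.replicate j E ++ N :: G := by
    rw [← hF, ← conj_conj F, hF', conj_append, conj_cons, conj_replicate]
    simp [FishLetter.swap]
  rcases locate (by decide) j _ e with ⟨-, h1, -⟩ | ⟨X, -, rfl⟩
  · exact absurd h1 (by decide)
  · obtain ⟨j, rfl⟩ := Nat.exists_eq_add_of_le' hj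
    obtain ⟨m, rfl⟩ := Nat.exists_eq_add_of_le' hm
    exact ⟨j, X, m, hF⟩

theorem concat_empty_left (F : List FishLetter) : concat [E, V, S] F = F := by
  simp [concat]

theorem concat_empty_right (F : List FishLetter) : concat F [E, V, S] = F := by
  by_cases h : F = [E, V, S] <;> simp [concat, h]

theorem concat_block (j k : ℕ) (X Y : List FishLetter) (m n : ℕ) :
    concat (block j X m) (block k Y n) =
      block (j + k + 1) (X ++ W :: (List.replicate m S ++ Y)) n := by
  have e : (block j X m).dropLast =
      List.replicate (j + 1) E ++ N :: (X ++ W :: List.replicate m S) := by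
    rw [show block j X m = (List.replicate (j + 1) E ++ N :: (X ++ W :: List.replicate m S)) ++ [S]
      by simp [block, List.replicate_succ'], List.dropLast_concat]
  rw [concat, if_neg (block_ne _ _ _), if_neg (block_ne _ _ _), jaw_block, drop_block, e, block,
    show j + k + 1 + 1 = (k + 1) + (j + 1) by omega]
  simp only [List.append_assoc, List.cons_append, List.replicate_add (k + 1)]

theorem concat_assoc {F₁ F₂ F₃ : List FishLetter} (h1 : IsExtendedFightingFish F₁)
    (h2 : IsExtendedFightingFish F₂) (h3 : IsExtendedFightingFish F₃) :
    concat (concat F₁ F₂) F₃ = concat F₁ (concat F₂ F₃) := by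
  rcases exists_block h1 with rfl | ⟨j, X, m, rfl⟩
  · simp only [concat_empty_left]
  rcases exists_block h2 with rfl | ⟨k, Y, n, rfl⟩
  · simp only [concat_empty_left, concat_empty_right]
  rcases exists_block h3 with rfl | ⟨l, Z, p, rfl⟩
  · simp only [concat_empty_right]
  simp only [concat_block]
  congr 1
  · omega
  · simp

theorem augment_empty (i : ℕ) : augment [E, V, S] i = block 0 [] 0 := by
  simp [augment, block]

theorem augment_block {i j : ℕ} (h : i ≤ j) (X : List FishLetter) (m : ℕ) :
    augment (block j X m) (i + 1) = block i (List.replicate (j - i) E ++ N :: X) (m + 1) := by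
  rw [augment, if_neg (block_ne _ _ _), if_pos (by rw [jaw_block]; omega), jaw_block, drop_block,
    show j + 1 - (i + 1) = j - i by omega, block, List.replicate_succ' (n := m + 1)]
  simp

theorem augment_block_last (j : ℕ) (X : List FishLetter) (m : ℕ) :
    augment (block j X m) (j + 2) = block (j + 1) (V :: X) (m + 1) := by
  rw [augment, if_neg (block_ne _ _ _), if_neg (by rw [jaw_block]; omega), jaw_block, drop_block,
    block, List.replicate_succ' (n := m + 1)]
  simp

/-- The concatenation of fish, transported by conjugation: for non-empty fish, `graft F₁ F₂` is
`F₂` with its last `W` replaced by `F₁` without its first letter. -/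
def graft (F₁ F₂ : List FishLetter) : List FishLetter := conj (concat (conj F₁) (conj F₂))

/-- The augmentation of fish, transported by conjugation: it acts on the final run `W S ^ m` and adds
a letter `E` in front. -/
def coaugment (F : List FishLetter) (i : ℕ) : List FishLetter := conj (augment (conj F) i)

theorem graft_empty_left (F : List FishLetter) : graft [E, V, S] F = F := by
  rw [graft, show conj [E, V, S] = [E, V, S] from rfl, concat_empty_left, conj_conj]

theorem graft_empty_right (F : List FishLetter) : graft F [E, V, S] = F := by
  rw [graft, show conj [E, V, S] = [E, V, S] from rfl, concat_empty_right, conj_conj]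

theorem graft_block (j k : ℕ) (X Y : List FishLetter) (m n : ℕ) :
    graft (block j X m) (block k Y n) =
      block k (Y ++ (List.replicate j E ++ N :: X)) (m + n + 1) := by
  rw [graft, conj_block, conj_block, concat_block, conj_block]
  simp [conj_append, conj_cons, conj_replicate, conj_conj, FishLetter.swap]

theorem coaugment_empty (i : ℕ) : coaugment [E, V, S] i = block 0 [] 0 := by
  rw [coaugment, show conj [E, V, S] = [E, V, S] from rfl, augment_empty]
  rfl

theorem coaugment_block {i m : ℕ} (h : i ≤ m) (j : ℕ) (X : List FishLetter) :
    coaugment (block j X m) (i + 1) =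
      block (j + 1) (X ++ W :: List.replicate (m - i) S) i := by
  rw [coaugment, conj_block, augment_block h, conj_block]
  simp [conj_append, conj_cons, conj_replicate, conj_conj, FishLetter.swap]

theorem coaugment_block_last (j : ℕ) (X : List FishLetter) (m : ℕ) :
    coaugment (block j X m) (m + 2) = block (j + 1) (X ++ [V]) (m + 1) := by
  rw [coaugment, conj_block, augment_block_last, conj_block]
  simp [conj_cons, conj_conj, FishLetter.swap]

/-- An index at which `block j X m` can be augmented is `i + 1` with `i ≤ j`, or `j + 2`. -/
theorem exists_index {i j : ℕ} (h1 : 1 ≤ i) (h2 : i ≤ j + 2) :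
    (∃ k ≤ j, i = k + 1) ∨ i = j + 2 := by
  by_cases h : i = j + 2
  · exact .inr h
  · exact .inl ⟨i - 1, by omega, by omega⟩

/-- The case `F₃ = EVS` has to be excluded: there the two sides are `graft F₁ F₂` and
`concat F₂ F₁`. -/
theorem graft_concat {F₁ F₂ F₃ : List FishLetter} (h1 : IsExtendedFightingFish F₁)
    (h2 : IsExtendedFightingFish F₂) (h3 : IsExtendedFightingFish F₃) (h : F₃ ≠ [E, V, S]) :
    graft F₁ (concat F₂ F₃) = concat F₂ (graft F₁ F₃) := by
  rcases exists_block h1 with rfl | ⟨j, X, m, rfl⟩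
  · simp only [graft_empty_left]
  rcases exists_block h2 with rfl | ⟨k, Y, n, rfl⟩
  · simp only [concat_empty_left]
  rcases exists_block h3 with rfl | ⟨l, Z, p, rfl⟩
  · exact absurd rfl h
  simp only [concat_block, graft_block]
  congr 1
  simp

theorem graft_augment {F₁ F₂ : List FishLetter} (h1 : IsExtendedFightingFish F₁)
    (h2 : IsExtendedFightingFish F₂) {i : ℕ} (hi : 1 ≤ i) (hj : i ≤ jaw F₂ + 1) :
    graft F₁ (augment F₂ i) = augment (graft F₁ F₂) i := by
  rcases exists_block h1 with rfl | ⟨j, X, m, rfl⟩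
  · simp only [graft_empty_left]
  rcases exists_block h2 with rfl | ⟨k, Y, n, rfl⟩
  · rw [show jaw [E, V, S] = 0 from rfl] at hj
    obtain rfl : i = 0 + 1 := by omega
    rw [augment_empty, graft_empty_right, graft_block, augment_block (Nat.zero_le _)]
    simp
  · rw [jaw_block] at hj
    rcases exists_index hi hj with ⟨i, hi₀, rfl⟩ | rfl
    · rw [augment_block hi₀, graft_block, graft_block, augment_block hi₀]
      simp [add_assoc]
    · rw [augment_block_last, graft_block, graft_block, augment_block_last]
      simp [add_assoc]

theorem jaw_conj_block (j : ℕ) (X : List FishLetter) (m : ℕ) :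
    jaw (conj (block j X m)) = m + 1 := by
  rw [conj_block, jaw_block]

theorem jaw_conj_concat {F₁ F₂ : List FishLetter} (h1 : IsExtendedFightingFish F₁)
    (h2 : IsExtendedFightingFish F₂) (h : F₂ ≠ [E, V, S]) :
    jaw (conj (concat F₁ F₂)) = jaw (conj F₂) := by
  rcases exists_block h1 with rfl | ⟨j, X, m, rfl⟩
  · rw [concat_empty_left]
  rcases exists_block h2 with rfl | ⟨k, Y, n, rfl⟩
  · exact absurd rfl h
  rw [concat_block, jaw_conj_block, jaw_conj_block]

theorem jaw_conj_augment {F : List FishLetter} (h : IsExtendedFightingFish F) {i : ℕ}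
    (hi : 1 ≤ i) (hj : i ≤ jaw F + 1) : jaw (conj (augment F i)) = jaw (conj F) + 1 := by
  rcases exists_block h with rfl | ⟨j, X, m, rfl⟩
  · rw [augment_empty, jaw_conj_block]
    rfl
  rw [jaw_block] at hj
  rcases exists_index hi hj with ⟨i, hi₀, rfl⟩ | rfl
  · rw [augment_block hi₀, jaw_conj_block, jaw_conj_block]
  · rw [augment_block_last, jaw_conj_block, jaw_conj_block]

/-- The first transported augmentation appends the head `ENWS`, just as `u d` is appended to both
paths if `R` is empty. -/
theorem coaugment_one {F : List FishLetter} (h : IsExtendedFightingFish F) :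
    coaugment F 1 = concat F [E, N, W, S] := by
  change _ = concat F (block 0 [] 0)
  rcases exists_block h with rfl | ⟨j, X, m, rfl⟩
  · rw [coaugment_empty, concat_empty_left]
  · rw [← zero_add 1, coaugment_block (Nat.zero_le _), concat_block]
    simp

theorem coaugment_concat {F₁ F₂ : List FishLetter} (h1 : IsExtendedFightingFish F₁)
    (h2 : IsExtendedFightingFish F₂) (h : F₂ ≠ [E, V, S]) {i : ℕ} (hi : 1 ≤ i)
    (hj : i ≤ jaw (conj F₂) + 1) :
    coaugment (concat F₁ F₂) i = concat F₁ (coaugment F₂ i) := by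
  rcases exists_block h1 with rfl | ⟨j, X, m, rfl⟩
  · simp only [concat_empty_left]
  rcases exists_block h2 with rfl | ⟨k, Y, n, rfl⟩
  · exact absurd rfl h
  rw [jaw_conj_block] at hj
  rcases exists_index hi hj with ⟨i, hi₀, rfl⟩ | rfl
  · rw [coaugment_block hi₀, concat_block, concat_block, coaugment_block hi₀]
    simp [add_assoc]
  · rw [coaugment_block_last, concat_block, concat_block, coaugment_block_last]
    simp [add_assoc]

/-- An augmentation and a transported augmentation commute, up to a shift of the indices. -/
theorem coaugment_augment {F : List FishLetter} (h : IsExtendedFightingFish F) {i k : ℕ}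
    (hi : 1 ≤ i) (hi' : i ≤ jaw (conj F) + 1) (hk : 1 ≤ k) (hk' : k ≤ jaw F + 1) :
    coaugment (augment F k) (i + 1) = augment (coaugment F i) (k + 1) := by
  rcases exists_block h with rfl | ⟨j, X, m, rfl⟩
  · rw [show jaw [E, V, S] = 0 from rfl] at hk'
    rw [show jaw (conj [E, V, S]) = 0 from rfl] at hi'
    obtain rfl : i = 1 := by omega
    obtain rfl : k = 1 := by omega
    rfl
  rw [jaw_block] at hk'
  rw [jaw_conj_block] at hi'
  rcases exists_index hi hi' with ⟨i, hi₀, rfl⟩ | rfl <;>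
  rcases exists_index hk hk' with ⟨k, hk₀, rfl⟩ | rfl
  · rw [augment_block hk₀, coaugment_block (Nat.succ_le_succ hi₀), coaugment_block hi₀,
      augment_block (Nat.succ_le_succ hk₀)]
    simp
  · rw [augment_block_last, coaugment_block (Nat.succ_le_succ hi₀), coaugment_block hi₀,
      augment_block_last]
    simp
  · rw [augment_block hk₀, coaugment_block_last, coaugment_block_last,
      augment_block (Nat.succ_le_succ hk₀)]
    simp
  · rw [augment_block_last, coaugment_block_last, coaugment_block_last, augment_block_last]
    simp

end FishWord

/-! ### The images of concatenation and grafting under `Φ` -/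

theorem FishWord.jaw_word (F : ExtendedFightingFish) : FishWord.jaw F.word = F.jaw := rfl

namespace TamariInterval

theorem concat_empty (I : TamariInterval) : I.concat empty = I :=
  TamariInterval.ext (add_zero _) (add_zero _)

theorem concat_assoc (I J K : TamariInterval) : (I.concat J).concat K = I.concat (J.concat K) :=
  TamariInterval.ext (add_assoc _ _ _) (add_assoc _ _ _)

theorem empty_concat (I : TamariInterval) : empty.concat I = I :=
  TamariInterval.ext (zero_add _) (zero_add _)

theorem leftComposition_eq (I : Pointed) (J : TamariInterval) :
    leftComposition I J = I.augment.concat J := rfl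

/-- Induction along the decomposition of intervals that defines `Φ`. -/
theorem leftComposition_induction {p : TamariInterval → Prop} (h0 : p empty)
    (h1 : ∀ I J, p I.interval → p J → p (leftComposition I J)) (I : TamariInterval) : p I := by
  by_cases h : I = empty
  · exact h ▸ h0
  · obtain ⟨⟨I₁, I₂⟩, hI⟩ := I.exists_leftComposition h
    have hs : I₁.interval.size + I₂.size + 1 = I.size := by rw [← size_leftComposition, hI]
    rw [← hI]
    exact h1 _ _ (leftComposition_induction h0 h1 _) (leftComposition_induction h0 h1 _)
termination_by I.size

theorem phi_word_leftComposition (I : Pointed) (J : TamariInterval) :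
    (leftComposition I J).phi.word =
      FishWord.concat (FishWord.augment I.interval.phi.word I.index) J.phi.word := by
  rw [phi_leftComposition]
  rfl

theorem phi_word_empty : empty.phi.word = [E, V, S] := by
  rw [phi_empty]
  rfl

theorem phi_word_augment (I : Pointed) :
    I.augment.phi.word = FishWord.augment I.interval.phi.word I.index := by
  rw [← concat_empty I.augment, ← leftComposition_eq, phi_word_leftComposition, phi_word_empty,
    FishWord.concat_empty_right]

theorem phi_word_concat (I J : TamariInterval) :
    (I.concat J).phi.word = FishWord.concat I.phi.word J.phi.word := by
  induction I using leftComposition_induction with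
  | h0 => rw [empty_concat, phi_word_empty, FishWord.concat_empty_left]
  | h1 I K _ ih =>
    rw [leftComposition_eq, concat_assoc, ← leftComposition_eq, ← leftComposition_eq,
      phi_word_leftComposition, phi_word_leftComposition, ih, FishWord.concat_assoc _ K.phi.isFish
        J.phi.isFish]
    exact FishWord.augment_isFish I.interval.phi.isFish (Nat.le_add_left 1 _)

theorem exists_phi_word_eq_block {I : TamariInterval} (h : I ≠ empty) :
    ∃ j X m, I.phi.word = FishWord.block j X m := by
  obtain ⟨⟨I, J⟩, rfl⟩ := I.exists_leftComposition h
  rw [phi_word_leftComposition]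
  have h1 : ∃ j X m, FishWord.augment I.interval.phi.word I.index = FishWord.block j X m := by
    have hi : 1 ≤ I.index := Nat.le_add_left 1 _
    have hi' : I.index ≤ FishWord.jaw I.interval.phi.word + 1 := by
      rw [FishWord.jaw_word, jaw_phi]
      exact I.index_le
    rcases FishWord.exists_block I.interval.phi.isFish with e | ⟨j, X, m, e⟩
    · rw [e, FishWord.augment_empty]
      exact ⟨_, _, _, rfl⟩
    · rw [e, FishWord.jaw_block] at hi'
      rw [e]
      rcases FishWord.exists_index hi hi' with ⟨i, h0, e'⟩ | e'
      · rw [e', FishWord.augment_block h0]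
        exact ⟨_, _, _, rfl⟩
      · rw [e', FishWord.augment_block_last]
        exact ⟨_, _, _, rfl⟩
  obtain ⟨j, X, m, e⟩ := h1
  rw [e]
  rcases FishWord.exists_block J.phi.isFish with e' | ⟨k, Y, n, e'⟩
  · rw [e', FishWord.concat_empty_right]
    exact ⟨_, _, _, rfl⟩
  · rw [e', FishWord.concat_block]
    exact ⟨_, _, _, rfl⟩

theorem phi_word_ne {I : TamariInterval} (h : I ≠ empty) : I.phi.word ≠ [E, V, S] := by
  obtain ⟨j, X, m, e⟩ := exists_phi_word_eq_block h
  rw [e]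
  exact FishWord.block_ne j X m

theorem lower_ne_zero {I : TamariInterval} (h : I ≠ empty) : I.lower ≠ 0 :=
  fun e => h (eq_empty (by rw [size, e]; rfl))

theorem upper_ne_zero {I : TamariInterval} (h : I ≠ empty) : I.upper ≠ 0 :=
  fun e => h (eq_empty (by rw [size, I.le.semilength_eq, e]; rfl))

theorem Pointed.one_le_index (I : Pointed) : 1 ≤ I.index := Nat.le_add_left 1 _

theorem Pointed.index_le_jaw (I : Pointed) : I.index ≤ FishWord.jaw I.interval.phi.word + 1 := by
  rw [FishWord.jaw_word, jaw_phi]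
  exact I.index_le

/-- The interval obtained by grafting both paths of an interval; this is concatenation transported
by conjugation. -/
def graft (I J : TamariInterval) : TamariInterval :=
  ⟨I.lower.graft J.lower, I.upper.graft J.upper, I.le.graft J.le⟩

theorem conj_concat (I J : TamariInterval) : (I.concat J).conj = I.conj.graft J.conj :=
  TamariInterval.ext (DyckWord.conj_add _ _) (DyckWord.conj_add _ _)

theorem graft_empty (I : TamariInterval) : I.graft empty = I :=
  TamariInterval.ext (DyckWord.graft_zero_right _) (DyckWord.graft_zero_right _)

theorem graft_concat (I J : TamariInterval) {K : TamariInterval} (h : K ≠ empty) :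
    I.graft (J.concat K) = J.concat (I.graft K) :=
  TamariInterval.ext (DyckWord.graft_add _ _ (lower_ne_zero h))
    (DyckWord.graft_add _ _ (upper_ne_zero h))

/-- Grafting commutes with augmentation, and preserves the index of the distinguished contact. -/
theorem graft_augment (I : TamariInterval) (J : Pointed) :
    ∃ K : Pointed, K.interval = I.graft J.interval ∧ K.index = J.index ∧
      I.graft J.augment = K.augment := by
  by_cases h : J.right = 0
  · refine ⟨⟨I.graft J.interval, I.lower.graft J.left, 0, ?_⟩, rfl, ?_, ?_⟩
    · change I.lower.graft J.interval.lower = _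
      rw [J.split, h, add_zero, add_zero]
    · exact congrArg (fun R : DyckWord => R.contacts + 1) h.symm
    · ext1
      · simp only [graft, Pointed.augment, h, add_zero, DyckWord.graft_nest]
      · exact DyckWord.graft_nest _ _
  · refine ⟨⟨I.graft J.interval, J.left, I.lower.graft J.right, ?_⟩, rfl, ?_, ?_⟩
    · change I.lower.graft J.interval.lower = _
      rw [J.split, DyckWord.graft_add _ _ h]
    · exact congrArg (· + 1) (DyckWord.contacts_graft _ h)
    · ext1
      · exact DyckWord.graft_nest_add _ _ h
      · exact DyckWord.graft_nest _ _

/-- `Φ` intertwines the grafting of intervals and of fish. The induction peels components off `J`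
until a single one is left, inside which the grafting takes place. -/
theorem phi_word_graft (I J : TamariInterval) :
    (I.graft J).phi.word = FishWord.graft I.phi.word J.phi.word := by
  induction J using leftComposition_induction with
  | h0 => rw [graft_empty, phi_word_empty, FishWord.graft_empty_right]
  | h1 J K ihJ ihK =>
    by_cases h : K = empty
    · subst h
      obtain ⟨M, h1, h2, h3⟩ := graft_augment I J
      rw [leftComposition_eq, concat_empty, h3, phi_word_augment, phi_word_augment, h1, h2, ihJ,
        FishWord.graft_augment I.phi.isFish J.interval.phi.isFish J.one_le_index
          J.index_le_jaw]
    · rw [leftComposition_eq, graft_concat _ _ h, phi_word_concat, ihK, phi_word_concat,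
        FishWord.graft_concat I.phi.isFish J.augment.phi.isFish K.phi.isFish (phi_word_ne h)]

/-! ### Transported augmentation and the conjugation theorem -/

/-- From `[P, graft L R]`, the interval `[P u d, graft (L u d) R]`. This is augmentation transported
by conjugation: `L` and `R` are the conjugates of the two parts of a pointed lower path. -/
def coaugment (I : TamariInterval) (L R : DyckWord) (h : I.upper = L.graft R) : TamariInterval :=
  ⟨I.lower + DyckWord.nest 0, (L + DyckWord.nest 0).graft R,
    (I.le.add (DyckWord.TamariLE.refl _)).trans (h ▸ DyckWord.graft_add_le _ _ _)⟩

theorem conj_augment (I : Pointed) :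
    I.augment.conj = I.interval.conj.coaugment I.left.conj I.right.conj
      (by rw [← DyckWord.conj_add, ← I.split]; rfl) := by
  ext1
  · exact DyckWord.conj_nest _
  · change DyckWord.conj (I.left.nest + I.right) = _
    rw [DyckWord.conj_add, DyckWord.conj_nest]
    rfl

/-- The mirror image of `jaw_phi`, proved beforehand in order to know which indices are admissible
for transported augmentations. -/
theorem jaw_conj_phi (I : TamariInterval) :
    FishWord.jaw (FishWord.conj I.phi.word) = I.upper.conj.contacts := by
  induction I using leftComposition_induction with
  | h0 =>
    rw [phi_word_empty, show empty.upper = 0 from rfl, DyckWord.conj_zero]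
    rfl
  | h1 I J ihI ihJ =>
    have hI : FishWord.jaw (FishWord.conj I.augment.phi.word) = I.augment.upper.conj.contacts := by
      rw [phi_word_augment, FishWord.jaw_conj_augment I.interval.phi.isFish I.one_le_index
        I.index_le_jaw, ihI, Pointed.augment, DyckWord.conj_nest, DyckWord.contacts_add,
        DyckWord.contacts_nest]
    by_cases h : J = empty
    · rw [h, leftComposition_eq, concat_empty, hI]
    · rw [leftComposition_eq, phi_word_concat, FishWord.jaw_conj_concat I.augment.phi.isFish
        J.phi.isFish (phi_word_ne h), ihJ, concat, DyckWord.conj_add,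
        DyckWord.contacts_graft _ (DyckWord.conj_ne_zero (upper_ne_zero h))]

/-- The index occurring in `phi_word_coaugment` is admissible. -/
theorem coaugment_index_le {I : TamariInterval} {L R : DyckWord} (h : I.upper = L.graft R) :
    R.conj.contacts + 1 ≤ FishWord.jaw (FishWord.conj I.phi.word) + 1 := by
  rw [jaw_conj_phi, h, DyckWord.conj_graft, DyckWord.contacts_add]
  omega

/-- `Φ` intertwines the transported augmentations. The induction descends into `R` towards its
last peak, where `L` and the new peak are placed. -/
theorem phi_word_coaugment (L R : DyckWord) : ∀ (I : TamariInterval) (h : I.upper = L.graft R),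
    (I.coaugment L R h).phi.word = FishWord.coaugment I.phi.word (R.conj.contacts + 1) := by
  induction R using DyckWord.component_induction with
  | h0 =>
    intro I h
    rw [DyckWord.graft_zero_right] at h
    have hp : (⟨empty, 0, 0, rfl⟩ : Pointed).augment.phi.word = [E, N, W, S] := by
      rw [phi_word_augment, phi_word_empty]
      rfl
    have e : I.coaugment L 0 (by rw [h, DyckWord.graft_zero_right]) =
        I.concat (⟨empty, 0, 0, rfl⟩ : Pointed).augment := by
      ext1
      · simp only [coaugment, concat, Pointed.augment, add_zero]
      · simp only [coaugment, concat, Pointed.augment, DyckWord.graft_zero_right, h]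
        rfl
    rw [e, phi_word_concat, hp, ← FishWord.coaugment_one I.phi.isFish, DyckWord.conj_zero,
      DyckWord.contacts_zero]
  | h1 A ih =>
    intro I h
    have hI : I ≠ empty := by
      rintro rfl
      rw [DyckWord.graft_nest] at h
      exact DyckWord.nest_ne_zero h.symm
    obtain ⟨⟨J, K⟩, rfl⟩ := I.exists_leftComposition hI
    have h' : J.interval.upper.nest + K.upper = (L.graft A).nest + 0 := by
      rw [add_zero, ← DyckWord.graft_nest, ← h]
      rfl
    -- the upper path has a single component, so the interval is an augmentation
    obtain ⟨hA, hK⟩ := DyckWord.nest_add_inj h'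
    obtain rfl : K = empty := by
      by_contra hK'
      exact upper_ne_zero hK' hK
    -- appending `u d` to the lower path shifts the index of the distinguished contact by one
    have e : (leftComposition J empty).coaugment L A.nest h = Pointed.augment
        ⟨J.interval.coaugment L A hA, J.left, J.right + DyckWord.nest 0,
          by
          change J.interval.lower + DyckWord.nest 0 = _
          rw [J.split, add_assoc]⟩ := by
      ext1
      · simp only [coaugment, leftComposition, concat_empty, Pointed.augment, add_assoc]
      · simp only [coaugment, Pointed.augment, DyckWord.graft_nest]
    rw [e, phi_word_augment, leftComposition_eq, concat_empty, phi_word_augment, ih,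
      DyckWord.conj_nest, DyckWord.contacts_add, DyckWord.contacts_nest,
      FishWord.coaugment_augment J.interval.phi.isFish (Nat.le_add_left 1 _)
        (coaugment_index_le hA) J.one_le_index J.index_le_jaw,
      Pointed.index, Pointed.index, DyckWord.contacts_add, DyckWord.contacts_nest]
  | h2 A C hC _ ih =>
    intro I h
    have hI : I ≠ empty := by
      rintro rfl
      rw [DyckWord.graft_nest_add _ _ hC] at h
      exact DyckWord.nest_add_ne_zero _ _ h.symm
    obtain ⟨⟨J, K⟩, rfl⟩ := I.exists_leftComposition hI
    have h' : J.interval.upper.nest + K.upper = A.nest + L.graft C := by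
      rw [← DyckWord.graft_nest_add _ _ hC, ← h]
      rfl
    obtain ⟨hA, hK⟩ := DyckWord.nest_add_inj h'
    have hK' : K ≠ empty := by
      rintro rfl
      exact DyckWord.graft_ne_zero L hC hK.symm
    have e : (leftComposition J K).coaugment L (A.nest + C) h =
        J.augment.concat (K.coaugment L C hK) := by
      ext1
      · simp only [coaugment, leftComposition, concat, add_assoc]
      · simp only [coaugment, concat, Pointed.augment, DyckWord.graft_nest_add _ _ hC, hA]
    rw [e, phi_word_concat, ih, leftComposition_eq, phi_word_concat, DyckWord.conj_add,
      DyckWord.contacts_graft _ (DyckWord.conj_ne_zero hC),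
      FishWord.coaugment_concat J.augment.phi.isFish K.phi.isFish (phi_word_ne hK')
        (Nat.le_add_left 1 _) (coaugment_index_le hK)]

theorem conj_phi (I : TamariInterval) : I.phi.conj = I.conj.phi := by
  apply ExtendedFightingFish.ext
  change FishWord.conj I.phi.word = _
  induction I using leftComposition_induction with
  | h0 =>
    rw [show empty.conj = empty from TamariInterval.ext DyckWord.conj_zero DyckWord.conj_zero,
      phi_word_empty]
    rfl
  | h1 I J ihI ihJ =>
    rw [phi_word_leftComposition, leftComposition_eq, conj_concat, phi_word_graft, conj_augment,
      phi_word_coaugment, ← ihI, ← ihJ, DyckWord.conj_conj, FishWord.coaugment, FishWord.graft,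
      FishWord.conj_conj, FishWord.conj_conj, FishWord.conj_conj]
    rfl

end TamariInterval

/-! ### Letter counts -/

namespace FishWord

theorem count_E_block (j : ℕ) (X : List FishLetter) (m : ℕ) :
    (FishWord.block j X m).count E = X.count E + j + 1 := by
  simp [FishWord.block, List.count_append, List.count_replicate]
  omega

theorem count_N_block (j : ℕ) (X : List FishLetter) (m : ℕ) :
    (FishWord.block j X m).count N = X.count N + 1 := by
  simp [FishWord.block, List.count_append, List.count_replicate]

theorem count_W_block (j : ℕ) (X : List FishLetter) (m : ℕ) :
    (FishWord.block j X m).count W = X.count W + 1 := by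
  simp [FishWord.block, List.count_append, List.count_replicate]

theorem count_S_block (j : ℕ) (X : List FishLetter) (m : ℕ) :
    (FishWord.block j X m).count S = X.count S + m + 1 := by
  simp [FishWord.block, List.count_append, List.count_replicate]
  omega

end FishWord

namespace DyckWord

theorem contacts_pos {P : DyckWord} (h : P ≠ 0) : 0 < P.contacts := by
  rw [← DyckWord.nest_insidePart_add_outsidePart h, DyckWord.contacts_nest_add]
  exact Nat.succ_pos _

end DyckWord

namespace TamariInterval

open FishWord (count_E_block count_N_block count_W_block count_S_block)

/-- The letter counts of `Φ(I)` are those of a non-empty interval `I`, in terms of valleys and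
double rises. -/
def HasLetterCounts (I : TamariInterval) : Prop :=
  I.phi.word.count E = I.lower.val + 1 ∧ I.phi.word.count N = I.lower.doubleRises + 1 ∧
  I.phi.word.count W = I.upper.val + 1 ∧ I.phi.word.count S = I.upper.doubleRises + 1

theorem hasLetterCounts_augment (I : Pointed)
    (h0 : I.interval ≠ empty → I.interval.HasLetterCounts) : I.augment.HasLetterCounts := by
  unfold HasLetterCounts at *
  by_cases hI : I.interval = empty
  · obtain ⟨I, L, R, hs⟩ := I
    subst hI
    obtain rfl : R = 0 := by
      by_contra h
      exact DyckWord.add_ne_zero_right h hs.symm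
    obtain rfl : L = 0 := (add_zero L).symm.trans hs.symm
    rw [phi_word_augment, phi_word_empty, FishWord.augment_empty]
    simp only [Pointed.augment]
    rw [add_zero]
    exact ⟨rfl, rfl, rfl, rfl⟩
  · obtain ⟨hE, hN, hW, hS⟩ := h0 hI
    obtain ⟨j, X, m, e⟩ := exists_phi_word_eq_block hI
    have hj : j + 1 = I.left.contacts + I.right.contacts := by
      rw [← FishWord.jaw_block j X m, ← e, FishWord.jaw_word, jaw_phi, I.split,
        DyckWord.contacts_add]
    have hlow := lower_ne_zero hI
    rw [e, count_E_block] at hE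
    rw [e, count_N_block] at hN
    rw [e, count_W_block] at hW
    rw [e, count_S_block] at hS
    rw [I.split] at hE hN hlow
    rw [DyckWord.doubleRises_add] at hN
    rw [phi_word_augment, e, Pointed.index]
    simp only [Pointed.augment]
    rw [DyckWord.val_nest, DyckWord.doubleRises_nest (upper_ne_zero hI), DyckWord.doubleRises_add]
    by_cases hL : I.left = 0
    -- the distinguished contact is the leftmost one, so the letter `V` appears
    · rw [hL, zero_add] at hE hlow
      rw [hL] at hN hj ⊢
      rw [DyckWord.contacts_zero, zero_add] at hj
      rw [← hj, FishWord.augment_block_last, count_E_block, count_N_block, count_W_block,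
        count_S_block, DyckWord.val_add DyckWord.nest_ne_zero hlow]
      have h1 : DyckWord.val (DyckWord.nest 0) = 0 := rfl
      have h2 : DyckWord.doubleRises (DyckWord.nest 0) = 0 := rfl
      have h3 : DyckWord.doubleRises 0 = 0 := rfl
      simp
      omega
    · have := DyckWord.contacts_pos hL
      have hv : DyckWord.val (I.left.nest + I.right) = DyckWord.val (I.left + I.right) := by
        by_cases hR : I.right = 0
        · rw [hR, add_zero, add_zero, DyckWord.val_nest]
        · rw [DyckWord.val_add DyckWord.nest_ne_zero hR, DyckWord.val_add hL hR,
            DyckWord.val_nest]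
      have hd := DyckWord.doubleRises_nest hL
      rw [FishWord.augment_block (by omega), count_E_block, count_N_block, count_W_block,
        count_S_block, hv]
      simp [List.count_append, List.count_replicate]
      omega

theorem hasLetterCounts (I : TamariInterval) : I ≠ empty → I.HasLetterCounts := by
  induction I using leftComposition_induction with
  | h0 => exact fun h => absurd rfl h
  | h1 I J ihI ihJ =>
    intro _
    have hA := hasLetterCounts_augment I ihI
    rw [leftComposition_eq]
    by_cases hJ : J = empty
    · rwa [hJ, concat_empty]
    have hI : I.augment ≠ empty := fun h => leftComposition_ne_empty I empty
      (by rw [leftComposition_eq, concat_empty, h])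
    unfold HasLetterCounts
    obtain ⟨hE, hN, hW, hS⟩ := hA
    obtain ⟨hE', hN', hW', hS'⟩ := ihJ hJ
    obtain ⟨j, X, m, e⟩ := exists_phi_word_eq_block hI
    obtain ⟨k, Y, n, e'⟩ := exists_phi_word_eq_block hJ
    rw [e, count_E_block] at hE
    rw [e, count_N_block] at hN
    rw [e, count_W_block] at hW
    rw [e, count_S_block] at hS
    rw [e', count_E_block] at hE'
    rw [e', count_N_block] at hN'
    rw [e', count_W_block] at hW'
    rw [e', count_S_block] at hS'
    rw [phi_word_concat, e, e', FishWord.concat_block, count_E_block, count_N_block,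
      count_W_block, count_S_block]
    simp only [concat]
    rw [DyckWord.val_add (lower_ne_zero hI) (lower_ne_zero hJ),
      DyckWord.val_add (upper_ne_zero hI) (upper_ne_zero hJ), DyckWord.doubleRises_add,
      DyckWord.doubleRises_add]
    simp [List.count_append, List.count_replicate]
    omega

end TamariInterval

theorem mainTheorem7 :
    (∀ I : TamariInterval, I.phi.conj = I.conj.phi) ∧
    (∀ I : TamariInterval,
      I.phi.word.count E = I.lower.val + 1 ∧ I.phi.word.count S = I.upper.doubleRises + 1) ∧
    (∀ I : TamariInterval, I ≠ TamariInterval.empty →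
      I.phi.word.count N = I.lower.doubleRises + 1 ∧ I.phi.word.count W = I.upper.val + 1) := by
  refine ⟨TamariInterval.conj_phi, fun I => ?_, fun I h => ?_⟩
  · by_cases h : I = TamariInterval.empty
    · rw [h, TamariInterval.phi_word_empty]
      exact ⟨rfl, rfl⟩
    · obtain ⟨hE, -, -, hS⟩ := I.hasLetterCounts h
      exact ⟨hE, hS⟩
  · obtain ⟨-, hN, hW, -⟩ := I.hasLetterCounts h
    exact ⟨hN, hW⟩
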